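/- All graphs are finite, simple and undirected, and $G[S]$ denotes the subgraph of $G$ induced by a vertex set $S$. A vertex set $S$ is a \emph{2-club} in $G$ if $G[S]$ has diameter at most two. It is a \emph{$t$-robust 2-club} if any two distinct vertices of $S$ are connected in $G[S]$ by $t$ internally vertex-disjoint paths of length at most two, and a \emph{$t$-hereditary 2-club} if $G[S\setminus U]$ is a 2-club for all $U\subseteq S$ with $|U|\le t$. The problem \textsc{$t$-Robust 2-Club} (\textsc{$t$-Hereditary 2-Club}) asks, given a graph $G$ and nonnegative integers $t$ and $k$, whether $G$ contains a $t$-robust (respectively $t$-hereditary) 2-club of size at least $k$; let $n$ be the number of vertices of $G$ and $\ell := n-k$. The Strong Exponential Time Hypothesis (SETH) states that for no $\varepsilon>0$ can the satisfiability of Boolean formulas $F$ in conjunctive normal form with $N$ variables be decided in time $(2-\varepsilon)^{N}\cdot |F|^{O(1)}$, where $|F|$ is the size of $F$. Running times, here and below, are numbers of steps of deterministic multi-tape Turing machines. \textbf{Theorem.} If SETH holds, then for every $\varepsilon>0$: (i) for every fixed $t\ge 1$, \textsc{$t$-Robust 2-Club} does not admit a $(2-\varepsilon)^{\ell}\cdot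 n^{O(1)}$-time algorithm, and (ii) for every fixed $t\ge 0$, \textsc{$t$-Hereditary 2-Club} does not admit a $(2-\varepsilon)^{\ell}\cdot n^{O(1)}$-time algorithm. Both statements hold even if the algorithm is only required to work for connected graphs and $k\le n$. -/

import Mathlib

/-- A set `S` of vertices is a 2-club of `G` if the induced subgraph `G[S]` has diameter at most
two (the extended diameter is infinite when `G[S]` is disconnected). -/
def IsTwoClub {V : Type} (G : SimpleGraph V) (S : Set V) : Prop :=
  (G.induce S).ediam ≤ 2

/-- `S` is a `t`-robust 2-club of `G`: any two distinct vertices of `S` are connected in `G[S]` by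
`t` (distinct) internally vertex-disjoint paths of length at most two. -/
def IsRobustTwoClub {V : Type} (t : ℕ) (G : SimpleGraph V) (S : Set V) : Prop :=
  ∀ u v : S, u ≠ v → ∃ P : Fin t → (G.induce S).Path u v,
    Function.Injective P ∧
    (∀ i, (P i : (G.induce S).Walk u v).length ≤ 2) ∧
    ∀ i j, i ≠ j → ∀ w, w ∈ (P i : (G.induce S).Walk u v).support →
      w ∈ (P j : (G.induce S).Walk u v).support → w = u ∨ w = v

/-- `S` is a `t`-hereditary 2-club of `G`: deleting at most `t` vertices of `S` leaves a 2-club. -/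
def IsHereditaryTwoClub {V : Type} (t : ℕ) (G : SimpleGraph V) (S : Set V) : Prop :=
  ∀ U : Finset V, (U : Set V) ⊆ S → U.card ≤ t → IsTwoClub G (S \ U)

/-- An instance of the (robust or hereditary) 2-club problem: a graph on `n` vertices and
nonnegative integers `t` and `k`. -/
structure ClubInstance where
  n : ℕ
  graph : SimpleGraph (Fin n)
  t : ℕ
  k : ℕ

/-- The question of `t`-Robust 2-Club. -/
def ClubInstance.HasRobustTwoClub (x : ClubInstance) : Prop :=
  ∃ S : Finset (Fin x.n), x.k ≤ S.card ∧ IsRobustTwoClub x.t x.graph (S : Set (Fin x.n))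

/-- The question of `t`-Hereditary 2-Club. -/
def ClubInstance.HasHereditaryTwoClub (x : ClubInstance) : Prop :=
  ∃ S : Finset (Fin x.n), x.k ≤ S.card ∧ IsHereditaryTwoClub x.t x.graph (S : Set (Fin x.n))

/-- A formula in conjunctive normal form over `numVars` variables, as a list of clauses; a clause
is a list of literals, and the literal `(i, b)` is satisfied when variable `i` has value `b`. -/
structure CNFFormula where
  numVars : ℕ
  clauses : List (List (Fin numVars × Bool))

def CNFFormula.Satisfiable (F : CNFFormula) : Prop :=
  ∃ a : Fin F.numVars → Bool, ∀ c ∈ F.clauses, ∃ l ∈ c, a l.1 = l.2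

/-! Inputs are strings over the three letters `some false`, `some true` and the separator `none`. -/

/-- The number `m` in unary, followed by a separator. -/
def encodeUnary (m : ℕ) : List (Option Bool) :=
  List.replicate m (some true) ++ [none]

/-- A literal is its sign followed by the index of its variable; a clause is the sequence of its
literals, closed by a separator; a formula is its number of variables and the sequence of its
clauses. -/
def CNFFormula.encode (F : CNFFormula) : List (Option Bool) :=
  encodeUnary F.numVars ++
    F.clauses.flatMap fun c => (c.flatMap fun l => some l.2 :: encodeUnary l.1) ++ [none]

open Classical in
/-- The numbers `t`, `k`, `n`, followed by the adjacency matrix, row by row. -/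
noncomputable def ClubInstance.encode (x : ClubInstance) : List (Option Bool) :=
  encodeUnary x.t ++ encodeUnary x.k ++ encodeUnary x.n ++
    (List.finRange x.n).flatMap fun i =>
      (List.finRange x.n).map fun j => some (decide (x.graph.Adj i j))

open Classical in
/-- Some (multi-tape) Turing machine, given the encoding of any `x : ι` in the range `valid`,
halts after at most `bound x` steps with the correct answer to the question `yes x`. -/
def SolvableInTime {ι : Type} (enc : ι → List (Option Bool)) (valid yes : ι → Prop)
    (bound : ι → ℝ) : Prop :=
  ∃ M : Turing.TM2ComputableAux (Option Bool) Bool, ∀ x, valid x → ∃ T : ℕ, (T : ℝ) ≤ bound x ∧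
    Nonempty (Turing.TM2OutputsInTime M.tm ((enc x).map M.inputAlphabet.symm)
      (some ([decide (yes x)].map M.outputAlphabet.symm)) T)

/-- The Strong Exponential Time Hypothesis: for no `ε > 0` can satisfiability of CNF formulas `F`
with `N` variables be decided in time `(2 - ε) ^ N * |F| ^ O(1)`. -/
def StrongExponentialTimeHypothesis : Prop :=
  ∀ ε : ℝ, 0 < ε → ¬ ∃ C c : ℕ,
    SolvableInTime CNFFormula.encode (fun _ => True) CNFFormula.Satisfiable
      fun F => C * (2 - ε) ^ F.numVars * (F.encode.length : ℝ) ^ c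

/-- For the fixed value `t`, the problem with question `yes` admits an algorithm with running time
`(2 - ε) ^ (n - k) * n ^ O(1)`, where `n` is the number of vertices. The algorithm is only required
to work on instances with this value of `t` (so it may be specific to `t`, and so may the
constants), with a connected graph and with `k ≤ n`. -/
def AdmitsDualParameterAlgorithm (yes : ClubInstance → Prop) (t : ℕ) (ε : ℝ) : Prop :=
  ∃ C c : ℕ,
    SolvableInTime ClubInstance.encode (fun x => x.t = t ∧ x.graph.Connected ∧ x.k ≤ x.n) yes
      fun x => C * (2 - ε) ^ (x.n - x.k) * (x.n : ℝ) ^ c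

/-! ### Reachability with a bound on the number of steps -/

/-! The proof is a polynomial-time reduction from satisfiability in which the dual parameter n - k
equals the number N of variables. One construction, with a parameter q, serves both problems: q = t
- 1 for the robust version and q = t for the hereditary one.

The graph has two vertices per variable (its literals), two copies of every clause (marked by a
sign), four hubs forming a clique, and q apexes adjacent to everything. Opposite literals of one
variable have no common neighbour except the apexes: a literal or a hub is adjacent to literals of
one sign only, and a clause is joined to a literal only if it does not contain the opposite one. The
two copies of a non-tautological clause are non-adjacent, and their common neighbours besides the
apexes are exactly the literals of the clause. Any other two vertices that are not apexes are
adjacent, share a hub, or are copies of clauses with the same literals.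

In either kind of club, non-adjacent vertices have q + 1 common neighbours (`IsLooselyLinked`),
hence one that is not an apex. So one literal of every variable is missing. If at most N vertices
are missing, nothing else is, and the remaining literals form an assignment that satisfies every
clause (`satisfiable_of_isLooselyLinked`). Conversely, deleting the false literals of a satisfying
assignment leaves a set in which any two vertices are adjacent with q common neighbours or have q +
1 of them (`isTightlyLinked_kept`); this condition, `IsTightlyLinked`, implies both kinds of club.

As running times refer to Turing machines, the reduction is carried out by explicit stack machines.
One turns the formula into a list of descriptors of the vertices, a tag and a vector indexed by the
variables each; another compares all pairs of descriptors and writes the encoded instance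
(`output_descs`). `FinTM2.comp` chains them with the hypothetical algorithm, and `decider_yields`
bounds the overhead by a cubic polynomial. -/

/-- `b` is reached from `a` in at most `T` steps of `f`. -/
def ReachesWithin {α : Type} (f : α → Option α) (T : ℕ) (a b : α) : Prop :=
  ∃ n ≤ T, (flip bind f)^[n] (some a) = some b

namespace ReachesWithin

variable {α β : Type} {f : α → Option α} {g : β → Option β} {a b c : α} {T T' : ℕ}

theorem refl (f : α → Option α) (a : α) : ReachesWithin f 0 a a := ⟨0, le_rfl, rfl⟩

theorem single (h : f a = some b) : ReachesWithin f 1 a b := ⟨1, le_rfl, h⟩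

theorem mono (h : ReachesWithin f T a b) (hT : T ≤ T') : ReachesWithin f T' a b :=
  let ⟨n, hn, e⟩ := h
  ⟨n, hn.trans hT, e⟩

theorem trans (h₁ : ReachesWithin f T a b) (h₂ : ReachesWithin f T' b c) :
    ReachesWithin f (T + T') a c := by
  obtain ⟨n, hn, e⟩ := h₁
  obtain ⟨n', hn', e'⟩ := h₂
  refine ⟨n' + n, by omega, ?_⟩
  rw [Function.iterate_add_apply, e, e']

theorem head (h₁ : f a = some b) (h₂ : ReachesWithin f T b c) : ReachesWithin f (T + 1) a c :=
  ((single h₁).trans h₂).mono (by omega)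

theorem iterate_none (f : α → Option α) (n : ℕ) : (flip bind f)^[n] none = none := by
  induction n with
  | zero => rfl
  | succ n ih => rw [Function.iterate_succ_apply]; exact ih

/-- A step-by-step simulation preserves bounded reachability. -/
theorem map (tr : α → β) (hstep : ∀ a b, f a = some b → g (tr a) = some (tr b))
    (h : ReachesWithin f T a b) : ReachesWithin g T (tr a) (tr b) := by
  obtain ⟨n, hn, e⟩ := h
  refine ⟨n, hn, ?_⟩
  clear hn
  induction n generalizing a with
  | zero => cases e; rfl
  | succ n ih =>
    rw [Function.iterate_succ_apply] at e ⊢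
    cases hfa : f a with
    | none =>
      have : flip bind f (some a) = none := hfa
      rw [this, iterate_none] at e
      cases e
    | some a' =>
      have h1 : flip bind f (some a) = some a' := hfa
      have h2 : flip bind g (some (tr a)) = some (tr a') := hstep _ _ hfa
      rw [h1] at e
      rw [h2]
      exact ih e

end ReachesWithin

/-! ### Halting computations as bounded reachability -/

namespace Turing

theorem nonempty_evalsToInTime_iff {α : Type} {f : α → Option α} {a b : α} {T : ℕ} :
    Nonempty (StateTransition.EvalsToInTime f a (some b) T) ↔ ReachesWithin f T a b :=
  ⟨fun ⟨h⟩ => ⟨h.steps, h.steps_le_m, h.evals_in_steps⟩, fun ⟨n, hn, e⟩ => ⟨⟨⟨n, e⟩, hn⟩⟩⟩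

theorem initList_eq (M : FinTM2) (s : List (M.Γ M.k₀)) :
    initList M s = ⟨some M.main, M.initialState, Function.update (fun _ => []) M.k₀ s⟩ := by
  unfold initList
  congr 1
  funext k
  by_cases h : k = M.k₀
  · subst h; simp
  · simp [h]

theorem haltList_eq (M : FinTM2) (s : List (M.Γ M.k₁)) :
    haltList M s = ⟨none, M.initialState, Function.update (fun _ => []) M.k₁ s⟩ := by
  unfold haltList
  congr 1
  funext k
  by_cases h : k = M.k₁
  · subst h; simp
  · simp [h]

/-- Started on the input `s`, the machine `M` halts within `T` steps with output `s'`. -/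
def FinTM2.Yields (M : FinTM2) (T : ℕ) (s : List (M.Γ M.k₀)) (s' : List (M.Γ M.k₁)) : Prop :=
  ReachesWithin M.step T
    ⟨some M.main, M.initialState, Function.update (fun _ => []) M.k₀ s⟩
    ⟨none, M.initialState, Function.update (fun _ => []) M.k₁ s'⟩

theorem FinTM2.nonempty_outputsInTime_iff (M : FinTM2) {T : ℕ} {s : List (M.Γ M.k₀)}
    {s' : List (M.Γ M.k₁)} :
    Nonempty (TM2OutputsInTime M s (some s') T) ↔ M.Yields T s s' := by
  unfold FinTM2.Yields
  rw [← initList_eq, ← haltList_eq]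
  exact nonempty_evalsToInTime_iff

/-! ### Sequential composition of machines -/

namespace FinTM2

variable (P M : FinTM2)

/-- The stack alphabets of the composition. -/
abbrev compΓ : P.K ⊕ M.K → Type
  | Sum.inl k => P.Γ k
  | Sum.inr k => M.Γ k

/-- The labels of the composition: those of `P`, the copying loop, and those of `M`. -/
abbrev CompΛ : Type := P.Λ ⊕ Option M.Λ

/-- The internal states of the composition; the last component holds the symbol being copied. -/
abbrev Compσ : Type := P.σ × M.σ × Option (M.Γ M.k₀)

open TM2.Stmt

/-- A statement of the first machine within the composition: halting becomes a jump to the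
copying loop. -/
def compLeft : TM2.Stmt P.Γ P.Λ P.σ → TM2.Stmt (compΓ P M) (CompΛ P M) (Compσ P M)
  | push k f q => push (Sum.inl k) (fun v => f v.1) (compLeft q)
  | peek k f q => peek (Sum.inl k) (fun v a => (f v.1 a, v.2)) (compLeft q)
  | pop k f q => pop (Sum.inl k) (fun v a => (f v.1 a, v.2)) (compLeft q)
  | load f q => load (fun v => (f v.1, v.2)) (compLeft q)
  | branch f q₁ q₂ => branch (fun v => f v.1) (compLeft q₁) (compLeft q₂)
  | goto f => goto fun v => Sum.inl (f v.1)
  | halt => goto fun _ => Sum.inr none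

/-- A statement of the second machine within the composition. -/
def compRight : TM2.Stmt M.Γ M.Λ M.σ → TM2.Stmt (compΓ P M) (CompΛ P M) (Compσ P M)
  | push k f q => push (Sum.inr k) (fun v => f v.2.1) (compRight q)
  | peek k f q => peek (Sum.inr k) (fun v a => (v.1, f v.2.1 a, v.2.2)) (compRight q)
  | pop k f q => pop (Sum.inr k) (fun v a => (v.1, f v.2.1 a, v.2.2)) (compRight q)
  | load f q => load (fun v => (v.1, f v.2.1, v.2.2)) (compRight q)
  | branch f q₁ q₂ => branch (fun v => f v.2.1) (compRight q₁) (compRight q₂)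
  | goto f => goto fun v => Sum.inr (some (f v.2.1))
  | halt => halt

/-- The loop that moves the output of the first machine, translated by `e`, to the input stack of
the second machine; this reverses the string. The symbol `d` is never used. -/
def compCopy (e : P.Γ P.k₁ → M.Γ M.k₀) (d : M.Γ M.k₀) :
    TM2.Stmt (compΓ P M) (CompΛ P M) (Compσ P M) :=
  pop (Sum.inl P.k₁) (fun v a => (v.1, v.2.1, a.map e)) <|
    branch (fun v => v.2.2.isSome)
      (push (Sum.inr M.k₀) (fun v => v.2.2.getD d) (goto fun _ => Sum.inr none))
      (goto fun _ => Sum.inr (some M.main))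

/-- The program of the composition. -/
def compProg (e : P.Γ P.k₁ → M.Γ M.k₀) (d : M.Γ M.k₀) :
    CompΛ P M → TM2.Stmt (compΓ P M) (CompΛ P M) (Compσ P M)
  | Sum.inl l => compLeft P M (P.m l)
  | Sum.inr none => compCopy P M e d
  | Sum.inr (some l) => compRight P M (M.m l)

/-- Run `P`, hand its reversed output over to `M`, and run `M`. -/
def comp (e : P.Γ P.k₁ → M.Γ M.k₀) (d : M.Γ M.k₀) : FinTM2 where
  K := P.K ⊕ M.K
  kFin := @instFintypeSum _ _ P.kFin M.kFin
  k₀ := Sum.inl P.k₀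
  k₁ := Sum.inr M.k₁
  Γ := compΓ P M
  Λ := CompΛ P M
  main := Sum.inl P.main
  ΛFin := @instFintypeSum _ _ P.ΛFin (@instFintypeOption _ M.ΛFin)
  σ := Compσ P M
  initialState := (P.initialState, M.initialState, none)
  σFin := @instFintypeProd _ _ P.σFin (@instFintypeProd _ _ M.σFin (@instFintypeOption _ M.Γk₀Fin))
  Γk₀Fin := P.Γk₀Fin
  m := compProg P M e d

/-- The stacks of the composition. -/
def compStk (S : ∀ k, List (P.Γ k)) (S' : ∀ k, List (M.Γ k)) : ∀ k, List (compΓ P M k)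
  | Sum.inl k => S k
  | Sum.inr k => S' k

variable {P M}

@[simp]
theorem compStk_inl (S : ∀ k, List (P.Γ k)) (S' : ∀ k, List (M.Γ k)) (k : P.K) :
    compStk P M S S' (Sum.inl k) = S k := rfl

@[simp]
theorem compStk_inr (S : ∀ k, List (P.Γ k)) (S' : ∀ k, List (M.Γ k)) (k : M.K) :
    compStk P M S S' (Sum.inr k) = S' k := rfl

@[simp]
theorem update_compStk_inl (S : ∀ k, List (P.Γ k)) (S' : ∀ k, List (M.Γ k)) (k : P.K)
    (x : List (P.Γ k)) :
    Function.update (compStk P M S S') (Sum.inl k) x =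
      compStk P M (Function.update S k x) S' := by
  funext j
  rcases j with j | j
  · by_cases h : j = k
    · subst h; simp
    · have : (Sum.inl j : P.K ⊕ M.K) ≠ Sum.inl k := fun h' => h (Sum.inl.inj h')
      rw [Function.update_of_ne this, compStk_inl, compStk_inl, Function.update_of_ne h]
  · rw [Function.update_of_ne (by simp)]; rfl

@[simp]
theorem update_compStk_inr (S : ∀ k, List (P.Γ k)) (S' : ∀ k, List (M.Γ k)) (k : M.K)
    (x : List (M.Γ k)) :
    Function.update (compStk P M S S') (Sum.inr k) x =
      compStk P M S (Function.update S' k x) := by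
  funext j
  rcases j with j | j
  · rw [Function.update_of_ne (by simp)]; rfl
  · by_cases h : j = k
    · subst h; simp
    · have : (Sum.inr j : P.K ⊕ M.K) ≠ Sum.inr k := fun h' => h (Sum.inr.inj h')
      rw [Function.update_of_ne this, compStk_inr, compStk_inr, Function.update_of_ne h]

/-- A configuration of the first machine within the composition. -/
def leftCfg (c : TM2.Cfg P.Γ P.Λ P.σ) : TM2.Cfg (compΓ P M) (CompΛ P M) (Compσ P M) :=
  ⟨some (c.l.elim (Sum.inr none) Sum.inl), (c.var, M.initialState, none),
    compStk P M c.stk fun _ => []⟩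

/-- A configuration of the second machine within the composition. -/
def rightCfg (c : TM2.Cfg M.Γ M.Λ M.σ) : TM2.Cfg (compΓ P M) (CompΛ P M) (Compσ P M) :=
  ⟨c.l.map fun l => Sum.inr (some l), (P.initialState, c.var, none),
    compStk P M (fun _ => []) c.stk⟩

/-- Since `leftCfg` sends a halted configuration to the entry of the copying loop, the simulation is
exact even for the step in which the first machine halts. -/
theorem stepAux_compLeft (q : TM2.Stmt P.Γ P.Λ P.σ) (v : P.σ) (S : ∀ k, List (P.Γ k)) :
    TM2.stepAux (compLeft P M q) (v, M.initialState, none) (compStk P M S fun _ => []) =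
      leftCfg (TM2.stepAux q v S) := by
  induction q generalizing v S with
  | push k f q ih => simpa [compLeft] using ih _ _
  | peek k f q ih => exact ih _ _
  | pop k f q ih => simpa [compLeft] using ih _ _
  | load f q ih => exact ih _ _
  | branch f q₁ q₂ ih₁ ih₂ =>
    simp only [compLeft, TM2.stepAux]
    cases f v
    · exact ih₂ _ _
    · exact ih₁ _ _
  | goto f => rfl
  | halt => rfl

theorem stepAux_compRight (q : TM2.Stmt M.Γ M.Λ M.σ) (v : M.σ) (S : ∀ k, List (M.Γ k)) :
    TM2.stepAux (compRight P M q) (P.initialState, v, none) (compStk P M (fun _ => []) S) =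
      rightCfg (TM2.stepAux q v S) := by
  induction q generalizing v S with
  | push k f q ih => simpa [compRight] using ih _ _
  | peek k f q ih => exact ih _ _
  | pop k f q ih => simpa [compRight] using ih _ _
  | load f q ih => exact ih _ _
  | branch f q₁ q₂ ih₁ ih₂ =>
    simp only [compRight, TM2.stepAux]
    cases f v
    · exact ih₂ _ _
    · exact ih₁ _ _
  | goto f => rfl
  | halt => rfl

variable (e : P.Γ P.k₁ → M.Γ M.k₀) (d : M.Γ M.k₀)

theorem step_leftCfg (c c' : TM2.Cfg P.Γ P.Λ P.σ) (h : TM2.step P.m c = some c') :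
    TM2.step (compProg P M e d) (leftCfg c) = some (leftCfg c') := by
  obtain ⟨l, v, S⟩ := c
  cases l with
  | none => cases h
  | some l =>
    obtain rfl : TM2.stepAux (P.m l) v S = c' := Option.some.inj h
    exact congrArg some (stepAux_compLeft _ _ _)

theorem step_rightCfg (c c' : TM2.Cfg M.Γ M.Λ M.σ) (h : TM2.step M.m c = some c') :
    TM2.step (compProg P M e d) (rightCfg c) = some (rightCfg c') := by
  obtain ⟨l, v, S⟩ := c
  cases l with
  | none => cases h
  | some l =>
    obtain rfl : TM2.stepAux (M.m l) v S = c' := Option.some.inj h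
    exact congrArg some (stepAux_compRight _ _ _)

/-- There is one step per symbol and one for the failing pop. That last pop also resets the copy
register to `none`, as `rightCfg` requires. -/
theorem reachesWithin_copy (s : List (P.Γ P.k₁)) (s' : List (M.Γ M.k₀)) (o : Option (M.Γ M.k₀)) :
    ReachesWithin (TM2.step (compProg P M e d)) (s.length + 1)
      ⟨some (Sum.inr none), (P.initialState, M.initialState, o),
        compStk P M (Function.update (fun _ => []) P.k₁ s)
          (Function.update (fun _ => []) M.k₀ s')⟩
      (rightCfg ⟨some M.main, M.initialState,
        Function.update (fun _ => []) M.k₀ (s.reverse.map e ++ s')⟩) := by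
  induction s generalizing s' o with
  | nil => exact ReachesWithin.single (by simp [compProg, compCopy, rightCfg])
  | cons a s ih =>
    refine ReachesWithin.head ?_ (by simpa using ih (e a :: s') (some (e a)))
    simp [compProg, compCopy]

/-- The composition runs `M` on the reversed output of `P`. -/
theorem Yields.comp {T T' : ℕ} {s : List (P.Γ P.k₀)} {w : List (P.Γ P.k₁)}
    {w' : List (M.Γ M.k₀)} {s' : List (M.Γ M.k₁)} (h : P.Yields T s w.reverse)
    (hw : w.map e = w') (h' : M.Yields T' w' s') :
    (comp P M e d).Yields (T + (w.length + 1) + T') s s' := by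
  subst hw
  have h₁ := ReachesWithin.map leftCfg (step_leftCfg e d) h
  have h₂ := reachesWithin_copy e d w.reverse [] none
  have h₃ := ReachesWithin.map rightCfg (step_rightCfg e d) h'
  simp only [List.append_nil, Function.update_eq_self, List.reverse_reverse,
    List.length_reverse] at h₂
  -- The three runs fit together because a halting machine is back in its initial state with all
  -- stacks but the output empty.
  have h₄ := (h₁.trans h₂).trans h₃
  have hz : compStk P M (fun _ => []) (fun _ => []) = fun _ => [] := by
    funext k; cases k <;> rfl
  simp only [leftCfg, rightCfg, Option.elim, Option.map, ← update_compStk_inl,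
    ← update_compStk_inr, hz] at h₄
  exact h₄

end FinTM2
end Turing

open Turing

/-! ### A machine that compares all pairs of a list of descriptors

A descriptor is a tag followed by a string of symbols. Two descriptors are compared by a Boolean
function of their tags and one of their tags and the pairs of symbols at equal positions. -/

/-- The parameters of a pairwise comparison. -/
structure PairTest (τ α : Type) where
  /-- the part of the test that depends on the tags only -/
  base : τ → τ → Bool
  /-- the test for two symbols at equal positions, given the tags -/
  sym : τ → τ → α → α → Bool
  /-- whether descriptors with this tag are counted -/
  counted : τ → Bool

namespace PairTest

variable {τ α : Type} (p : PairTest τ α)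

/-- The result of a comparison. -/
def bit (d e : τ × List α) : Bool :=
  p.base d.1 e.1 || (d.2.zip e.2).any fun x => p.sym d.1 e.1 x.1 x.2

/-- A descriptor as a string. -/
def word (d : τ × List α) : List (τ ⊕ α) := Sum.inl d.1 :: d.2.map Sum.inr

/-- A list of descriptors as a string. -/
def words (D : List (τ × List α)) : List (τ ⊕ α) := D.flatMap word

@[simp]
theorem words_nil : words ([] : List (τ × List α)) = [] := rfl

@[simp]
theorem words_cons (d : τ × List α) (D : List (τ × List α)) :
    words (d :: D) = Sum.inl d.1 :: (d.2.map Sum.inr ++ words D) := by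
  simp [words, word]

/-- The output of the machine: `t`, the number of counted descriptors and the number of all
descriptors, in unary, followed by the results of all comparisons. -/
def output (t : ℕ) (D : List (τ × List α)) : List (Option Bool) :=
  encodeUnary t ++ encodeUnary (D.countP fun d => p.counted d.1) ++ encodeUnary D.length ++
    D.flatMap fun d => D.map fun e => some (p.bit d e)

/-- The stacks: input, three work copies of the list, the symbols of the current row that are yet
to be compared and those already compared, and the output. -/
inductive Stack
  | inp | rev | todo | done | ahead | behind | out
  deriving DecidableEq

instance : Fintype Stack :=
  ⟨{.inp, .rev, .todo, .done, .ahead, .behind, .out}, fun x => by cases x <;> simp⟩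

/-- The labels of the program. -/
inductive Label
  | start | countSome | countAll | row | readRow | rewind | column | compare | restore | clear
  | finish
  deriving DecidableEq

instance : Fintype Label :=
  ⟨{.start, .countSome, .countAll, .row, .readRow, .rewind, .column, .compare, .restore, .clear,
    .finish}, fun x => by cases x <;> simp⟩

/-- The stack alphabets. -/
abbrev Alph (τ α : Type) : Stack → Type
  | .inp | .rev | .todo | .done => τ ⊕ α
  | .ahead | .behind => α
  | .out => Option Bool

/-- The registers: the last token read, the last symbol read, the tags of the current row and
column, and the result so far. -/
structure Reg (τ α : Type) where
  tok : Option (τ ⊕ α)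
  chr : Option α
  rowTag : Option τ
  colTag : Option τ
  acc : Bool

/-- The registers as a tuple. -/
def Reg.equiv (τ α : Type) :
    Reg τ α ≃ Option (τ ⊕ α) × Option α × Option τ × Option τ × Bool where
  toFun r := (r.tok, r.chr, r.rowTag, r.colTag, r.acc)
  invFun x := ⟨x.1, x.2.1, x.2.2.1, x.2.2.2.1, x.2.2.2.2⟩
  left_inv _ := rfl
  right_inv _ := rfl

instance [Fintype τ] [Fintype α] : Fintype (Reg τ α) := Fintype.ofEquiv _ (Reg.equiv τ α).symm

/-- The initial registers. -/
def Reg.init (τ α : Type) : Reg τ α := ⟨none, none, none, none, false⟩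

/-- The tag of a token. -/
def tag? (a : Option (τ ⊕ α)) : Option τ := a.bind Sum.getLeft?

/-- The symbol of a token. -/
def sym? (a : Option (τ ⊕ α)) : Option α := a.bind Sum.getRight?

@[simp] theorem tag?_none : tag? (none : Option (τ ⊕ α)) = none := rfl
@[simp] theorem tag?_inl (x : τ) : tag? (some (Sum.inl x : τ ⊕ α)) = some x := rfl
@[simp] theorem tag?_inr (x : α) : tag? (some (Sum.inr x : τ ⊕ α)) = none := rfl
@[simp] theorem sym?_none : sym? (none : Option (τ ⊕ α)) = none := rfl
@[simp] theorem sym?_inl (x : τ) : sym? (some (Sum.inl x : τ ⊕ α)) = none := rfl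
@[simp] theorem sym?_inr (x : α) : sym? (some (Sum.inr x : τ ⊕ α)) = some x := rfl

open TM2.Stmt

/-- Push a string, its first letter first. -/
def _root_.Turing.TM2.Stmt.pushList {K : Type} {Γ : K → Type} {Λ σ : Type} (k : K) :
    List (Γ k) → TM2.Stmt Γ Λ σ → TM2.Stmt Γ Λ σ
  | [], q => q
  | a :: l, q => push k (fun _ => a) (pushList k l q)

@[simp]
theorem _root_.Turing.TM2.stepAux_pushList {K : Type} [DecidableEq K] {Γ : K → Type} {Λ σ : Type}
    (k : K) (l : List (Γ k)) (q : TM2.Stmt Γ Λ σ) (v : σ) (S : ∀ k, List (Γ k)) :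
    TM2.stepAux (pushList k l q) v S =
      TM2.stepAux q v (Function.update S k (l.reverse ++ S k)) := by
  induction l generalizing S with
  | nil => simp [pushList]
  | cons a l ih => simp [pushList, ih]

/-- The value of the combined test on the symbols at one position. -/
def symTest (r : Reg τ α) (a : α) : Bool :=
  match r.rowTag, r.colTag, sym? r.tok with
  | some x, some y, some b => p.sym x y a b
  | _, _, _ => false

/-- The value of the test on the tags. -/
def baseTest (x y : Option τ) : Bool :=
  match x, y with
  | some x, some y => p.base x y
  | _, _ => false

variable (t : ℕ) (x₀ : τ ⊕ α) (a₀ : α)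

/-- The program. The symbols `x₀` and `a₀` are never used. -/
def prog : Label → TM2.Stmt (Alph τ α) Label (Reg τ α)
  | .start => pushList .out (encodeUnary t) (goto fun _ => .countSome)
  | .countSome => pop .inp (fun r a => { r with tok := a }) <|
      branch (fun r => r.tok.isSome)
        (push .rev (fun r => r.tok.getD x₀) <|
          branch (fun r => (tag? r.tok).any p.counted)
            (push .out (fun _ => some true) (goto fun _ => .countSome))
            (goto fun _ => .countSome))
        (push .out (fun _ => none) (goto fun _ => .countAll))
  | .countAll => pop .rev (fun r a => { r with tok := a }) <|
      branch (fun r => r.tok.isSome)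
        (push .inp (fun r => r.tok.getD x₀) <| push .todo (fun r => r.tok.getD x₀) <|
          branch (fun r => (tag? r.tok).isSome)
            (push .out (fun _ => some true) (goto fun _ => .countAll))
            (goto fun _ => .countAll))
        (push .out (fun _ => none) (goto fun _ => .row))
  | .row => pop .inp (fun r a => { r with tok := a }) <|
      branch (fun r => r.tok.isSome)
        (load (fun r => { r with rowTag := tag? r.tok }) (goto fun _ => .readRow))
        (goto fun _ => .finish)
  | .readRow => peek .inp (fun r a => { r with tok := a }) <|
      branch (fun r => (sym? r.tok).isSome)
        (pop .inp (fun r _ => r) <| push .behind (fun r => (sym? r.tok).getD a₀) <|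
          goto fun _ => .readRow)
        (goto fun _ => .rewind)
  | .rewind => pop .behind (fun r a => { r with chr := a }) <|
      branch (fun r => r.chr.isSome)
        (push .ahead (fun r => r.chr.getD a₀) (goto fun _ => .rewind))
        (goto fun _ => .column)
  | .column => pop .todo (fun r a => { r with tok := a }) <|
      branch (fun r => r.tok.isSome)
        (push .done (fun r => r.tok.getD x₀) <|
          load (fun r => { r with
            colTag := tag? r.tok, acc := p.baseTest r.rowTag (tag? r.tok) }) <|
          goto fun _ => .compare)
        (goto fun _ => .restore)
  | .compare => peek .todo (fun r a => { r with tok := a }) <|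
      branch (fun r => (sym? r.tok).isSome)
        (pop .todo (fun r _ => r) <| push .done (fun r => r.tok.getD x₀) <|
          pop .ahead (fun r a => { r with chr := a, acc := r.acc || a.any (p.symTest r) }) <|
          branch (fun r => r.chr.isSome)
            (push .behind (fun r => r.chr.getD a₀) (goto fun _ => .compare))
            (goto fun _ => .compare))
        (push .out (fun r => some r.acc) <| load (fun r => { r with chr := none }) <|
          goto fun _ => .rewind)
  | .restore => pop .done (fun r a => { r with tok := a }) <|
      branch (fun r => r.tok.isSome)
        (push .todo (fun r => r.tok.getD x₀) (goto fun _ => .restore))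
        (goto fun _ => .clear)
  | .clear => pop .ahead (fun r a => { r with chr := a }) <|
      branch (fun r => r.chr.isSome) (goto fun _ => .clear) (goto fun _ => .row)
  | .finish => pop .todo (fun r a => { r with tok := a }) <|
      branch (fun r => r.tok.isSome) (goto fun _ => .finish)
        (load (fun _ => Reg.init τ α) halt)

/-- The machine. -/
def machine [Fintype τ] [Fintype α] : FinTM2 where
  K := Stack
  k₀ := .inp
  k₁ := .out
  Γ := Alph τ α
  Λ := Label
  main := .start
  σ := Reg τ α
  initialState := Reg.init τ α
  Γk₀Fin := inferInstanceAs (Fintype (τ ⊕ α))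
  m := p.prog t x₀ a₀

/-- The stacks with the given contents. -/
def stk (inp rev todo done : List (τ ⊕ α)) (ahead behind : List α) (out : List (Option Bool)) :
    ∀ k, List (Alph τ α k)
  | .inp => inp
  | .rev => rev
  | .todo => todo
  | .done => done
  | .ahead => ahead
  | .behind => behind
  | .out => out

section
variable (i r u d : List (τ ⊕ α)) (a b : List α) (o : List (Option Bool))

@[simp] theorem stk_inp : stk i r u d a b o .inp = i := rfl
@[simp] theorem stk_rev : stk i r u d a b o .rev = r := rfl
@[simp] theorem stk_todo : stk i r u d a b o .todo = u := rfl
@[simp] theorem stk_done : stk i r u d a b o .done = d := rfl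
@[simp] theorem stk_ahead : stk i r u d a b o .ahead = a := rfl
@[simp] theorem stk_behind : stk i r u d a b o .behind = b := rfl
@[simp] theorem stk_out : stk i r u d a b o .out = o := rfl

@[simp] theorem update_stk_inp (x) :
    Function.update (stk i r u d a b o) .inp x = stk x r u d a b o := by
  funext k; cases k <;> rfl
@[simp] theorem update_stk_rev (x) :
    Function.update (stk i r u d a b o) .rev x = stk i x u d a b o := by
  funext k; cases k <;> rfl
@[simp] theorem update_stk_todo (x) :
    Function.update (stk i r u d a b o) .todo x = stk i r x d a b o := by
  funext k; cases k <;> rfl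
@[simp] theorem update_stk_done (x) :
    Function.update (stk i r u d a b o) .done x = stk i r u x a b o := by
  funext k; cases k <;> rfl
@[simp] theorem update_stk_ahead (x) :
    Function.update (stk i r u d a b o) .ahead x = stk i r u d x b o := by
  funext k; cases k <;> rfl
@[simp] theorem update_stk_behind (x) :
    Function.update (stk i r u d a b o) .behind x = stk i r u d a x o := by
  funext k; cases k <;> rfl
@[simp] theorem update_stk_out (x) :
    Function.update (stk i r u d a b o) .out x = stk i r u d a b x := by
  funext k; cases k <;> rfl

end

/-! ### Runs of the comparison program, loop by loop -/

/-- Bounded reachability for the program. -/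
abbrev Reach (T : ℕ) (l : Label) (r : Reg τ α) (S : ∀ k, List (Alph τ α k)) (l' : Label)
    (r' : Reg τ α) (S' : ∀ k, List (Alph τ α k)) : Prop :=
  ReachesWithin (TM2.step (p.prog t x₀ a₀)) T ⟨some l, r, S⟩ ⟨some l', r', S'⟩

theorem reach_countSome (w i' : List (τ ⊕ α)) (u d a b o) (r : Reg τ α) :
    p.Reach t x₀ a₀ (w.length + 1) .countSome r (stk w i' u d a b o)
      .countAll { r with tok := none }
      (stk [] (w.reverse ++ i') u d a b
        (none :: (List.replicate (w.countP fun x => (tag? (some x)).any p.counted) (some true)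
          ++ o))) := by
  induction w generalizing i' o r with
  | nil => exact .single (by simp [prog])
  | cons x w ih =>
    by_cases hx : (tag? (some x)).any p.counted = true
    · have h := ih (x :: i') (some true :: o) { r with tok := some x }
      refine .head ?_ (by simpa [hx, List.replicate_succ'] using h)
      simp [prog, hx]
    · refine .head ?_ (by simpa [hx] using ih (x :: i') o { r with tok := some x })
      simp [prog, hx]

/-- The counting pass before this one left the list reversed on `rev`; this pass restores its order
and duplicates it, so that rows are read from `inp` and columns from `todo`. -/
theorem reach_countAll (w i u d : List (τ ⊕ α)) (a b o) (r : Reg τ α) :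
    p.Reach t x₀ a₀ (w.length + 1) .countAll r (stk i w u d a b o)
      .row { r with tok := none }
      (stk (w.reverse ++ i) [] (w.reverse ++ u) d a b
        (none :: (List.replicate (w.countP fun x => (tag? (some x)).isSome) (some true)
          ++ o))) := by
  induction w generalizing i u o r with
  | nil => exact .single (by simp [prog])
  | cons x w ih =>
    by_cases hx : (tag? (some x)).isSome = true
    · have h := ih (x :: i) (x :: u) (some true :: o) { r with tok := some x }
      refine .head ?_ (by simpa [hx, List.replicate_succ'] using h)
      simp [prog, hx]
    · refine .head ?_ (by simpa [hx] using ih (x :: i) (x :: u) o { r with tok := some x })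
      simp [prog, hx]

/-- The end of a row is recognised by the next tag or the end of the list. The program peeks, so
that this tag stays on the stack. -/
theorem reach_readRow (v b : List α) (w v' u d : List (τ ⊕ α)) (a o) (r : Reg τ α)
    (hw : sym? w.head? = none) :
    p.Reach t x₀ a₀ (v.length + 1) .readRow r (stk (v.map Sum.inr ++ w) v' u d a b o)
      .rewind { r with tok := w.head? } (stk w v' u d a (v.reverse ++ b) o) := by
  induction v generalizing b r with
  | nil => exact .single (by simp [prog, hw])
  | cons x v ih =>
    refine .head ?_ (by simpa using ih (x :: b) { r with tok := some (Sum.inr x) })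
    simp [prog]

theorem reach_rewind (v a : List α) (i v' u d : List (τ ⊕ α)) (o) (r : Reg τ α) :
    p.Reach t x₀ a₀ (v.length + 1) .rewind r (stk i v' u d a v o)
      .column { r with chr := none } (stk i v' u d (v.reverse ++ a) [] o) := by
  induction v generalizing a r with
  | nil => exact .single (by simp [prog])
  | cons x v ih =>
    refine .head ?_ (by simpa using ih (x :: a) { r with chr := some x })
    simp [prog]

theorem reach_restore (w i v' u : List (τ ⊕ α)) (a b o) (r : Reg τ α) :
    p.Reach t x₀ a₀ (w.length + 1) .restore r (stk i v' u w a b o)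
      .clear { r with tok := none } (stk i v' (w.reverse ++ u) [] a b o) := by
  induction w generalizing u r with
  | nil => exact .single (by simp [prog])
  | cons x w ih =>
    refine .head ?_ (by simpa using ih (x :: u) { r with tok := some x })
    simp [prog]

theorem reach_clear (v : List α) (i v' u d : List (τ ⊕ α)) (b o) (r : Reg τ α) :
    p.Reach t x₀ a₀ (v.length + 1) .clear r (stk i v' u d v b o)
      .row { r with chr := none } (stk i v' u d [] b o) := by
  induction v generalizing r with
  | nil => exact .single (by simp [prog])
  | cons x v ih =>
    refine .head ?_ (by simpa using ih { r with chr := some x })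
    simp [prog]

/-- Halting correctly means leaving only the output behind, so the column copy is erased and the
registers are reset. -/
theorem reaches_finish (w : List (τ ⊕ α)) (i v' d : List (τ ⊕ α)) (a b o) (r : Reg τ α) :
    ReachesWithin (TM2.step (p.prog t x₀ a₀)) (w.length + 1)
      ⟨some .finish, r, stk i v' w d a b o⟩ ⟨none, Reg.init τ α, stk i v' [] d a b o⟩ := by
  induction w generalizing r with
  | nil => exact .single (by simp [prog])
  | cons x w ih =>
    refine .head ?_ (by simpa using ih { r with tok := some x })
    simp [prog]

theorem reach_compare (x y : τ) (v a b : List α) (w i v' d : List (τ ⊕ α)) (o) (r : Reg τ α)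
    (hw : sym? w.head? = none) (hx : r.rowTag = some x) (hy : r.colTag = some y) :
    p.Reach t x₀ a₀ (v.length + 1) .compare r (stk i v' (v.map Sum.inr ++ w) d a b o)
      .rewind { r with
        tok := w.head?
        chr := none
        acc := r.acc || (a.zip v).any fun z => p.sym x y z.1 z.2 }
      (stk i v' w ((v.map Sum.inr).reverse ++ d) (a.drop v.length)
        ((a.take v.length).reverse ++ b)
        (some (r.acc || (a.zip v).any fun z => p.sym x y z.1 z.2) :: o)) := by
  induction v generalizing a b d r with
  | nil => exact .single (by simp [prog, hw])
  | cons c v ih =>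
    cases a with
    -- The row vector is exhausted: popping `ahead` gives `none` and leaves `acc` unchanged, just as
    -- `zip` truncates.
    | nil =>
      have h := ih [] b (Sum.inr c :: d)
        { r with tok := some (Sum.inr c), chr := none } hx hy
      refine .head ?_ (by simpa using h)
      simp [prog]
    | cons e a =>
      have h := ih a (e :: b) (Sum.inr c :: d)
        { r with tok := some (Sum.inr c), chr := some e, acc := r.acc || p.sym x y e c } hx hy
      refine .head ?_ (by simpa [Bool.or_assoc] using h)
      simp [prog, symTest, hx, hy]

theorem sym?_head?_words (D : List (τ × List α)) : sym? (words D).head? = none := by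
  cases D <;> simp

theorem reach_column (x : τ) (e : τ × List α) (E : List (τ × List α)) (i v' d : List (τ ⊕ α))
    (a o) (r : Reg τ α) (hx : r.rowTag = some x) :
    ∃ r', r'.rowTag = some x ∧
    p.Reach t x₀ a₀ ((word e).length + a.length + 2) .column r
      (stk i v' (words (e :: E)) d a [] o)
      .column r'
      (stk i v' (words E) ((word e).reverse ++ d) a [] (some (p.bit (x, a) e) :: o)) := by
  have h₁ := p.reach_compare t x₀ a₀ x e.1 e.2 a [] (words E) i v' (Sum.inl e.1 :: d) o
    { r with tok := some (Sum.inl e.1), colTag := some e.1, acc := p.base x e.1 }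
    (sym?_head?_words E) hx rfl
  -- Rewinding puts the compared part of the row back in front of the rest, so the next column meets
  -- the whole row again.
  have h₂ := p.reach_rewind t x₀ a₀ ((a.take e.2.length).reverse ++ []) (a.drop e.2.length) i v'
    (words E) ((e.2.map Sum.inr).reverse ++ Sum.inl e.1 :: d)
    (some (p.bit (x, a) e) :: o)
    { r with
      tok := (words E).head?
      chr := none
      colTag := some e.1
      acc := p.bit (x, a) e }
  have h₃ := h₁.trans h₂
  have hd : (e.2.map Sum.inr).reverse ++ Sum.inl e.1 :: d = (word e).reverse ++ d := by
    simp [word]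
  simp only [List.append_nil, List.reverse_reverse, List.take_append_drop, hd] at h₃
  refine ⟨_, ?_, ReachesWithin.mono (.head ?_ h₃) ?_⟩
  · exact hx
  · simp [prog, hx, baseTest]
  · simp [word]
    omega

theorem reach_columns (x : τ) (E : List (τ × List α)) (i v' d : List (τ ⊕ α))
    (a o) (r : Reg τ α) (hx : r.rowTag = some x) :
    ∃ r', p.Reach t x₀ a₀ ((words E).length + E.length * (a.length + 2) + 1) .column r
      (stk i v' (words E) d a [] o) .restore r'
      (stk i v' [] ((words E).reverse ++ d) a []
        ((E.map fun e => some (p.bit (x, a) e)).reverse ++ o)) := by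
  induction E generalizing d o r with
  | nil =>
    exact ⟨{ r with tok := none }, ReachesWithin.mono (T := 1) (.single (by simp [prog])) (by simp)⟩
  | cons e E ih =>
    obtain ⟨r₁, hr₁, h₁⟩ := p.reach_column t x₀ a₀ x e E i v' d a o r hx
    obtain ⟨r₂, h₂⟩ := ih ((word e).reverse ++ d) (some (p.bit (x, a) e) :: o) r₁ hr₁
    have h := h₁.trans h₂
    have hd : (words E).reverse ++ ((word e).reverse ++ d) = (words (e :: E)).reverse ++ d := by
      simp [word]
    rw [hd] at h
    refine ⟨r₂, ReachesWithin.mono (by simpa using h) ?_⟩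
    simp [word]
    nlinarith

theorem reach_row (d : τ × List α) (D E : List (τ × List α)) (o) (r : Reg τ α) :
    ∃ r', p.Reach t x₀ a₀ (3 * d.2.length + 2 * (words E).length + E.length * (d.2.length + 2) + 6)
      .row r (stk (words (d :: D)) [] (words E) [] [] [] o) .row r'
      (stk (words D) [] (words E) [] [] []
        ((E.map fun e => some (p.bit d e)).reverse ++ o)) := by
  have h₁ := p.reach_readRow t x₀ a₀ d.2 [] (words D) [] (words E) [] [] o
    { r with tok := some (Sum.inl d.1), rowTag := some d.1 } (sym?_head?_words D)
  have h₂ := h₁.trans (p.reach_rewind t x₀ a₀ _ [] _ _ _ _ _ _)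
  simp only [List.append_nil, List.reverse_reverse] at h₂
  obtain ⟨r₃, h₃⟩ := p.reach_columns t x₀ a₀ d.1 E (words D) [] [] d.2 o
    { r with tok := (words D).head?, chr := none, rowTag := some d.1 } rfl
  have h₄ := ((h₂.trans h₃).trans (p.reach_restore t x₀ a₀ _ _ _ _ _ _ _ _)).trans
    (p.reach_clear t x₀ a₀ _ _ _ _ _ _ _ _)
  simp only [List.append_nil, List.reverse_reverse] at h₄
  refine ⟨_, ReachesWithin.mono (.head ?_ h₄) ?_⟩
  · simp [prog]
  · simp
    omega

theorem reach_rows (D E : List (τ × List α)) (B : ℕ) (hB : ∀ d ∈ D, d.2.length ≤ B) (o)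
    (r : Reg τ α) :
    ∃ r', p.Reach t x₀ a₀ (D.length * (3 * B + 2 * (words E).length + E.length * (B + 2) + 6) + 1)
      .row r (stk (words D) [] (words E) [] [] [] o) .finish r'
      (stk [] [] (words E) [] [] []
        ((D.flatMap fun d => E.map fun e => some (p.bit d e)).reverse ++ o)) := by
  induction D generalizing o r with
  | nil =>
    exact ⟨{ r with tok := none }, ReachesWithin.mono (T := 1) (.single (by simp [prog])) (by simp)⟩
  | cons d D ih =>
    obtain ⟨r₁, h₁⟩ := p.reach_row t x₀ a₀ d D E o r
    obtain ⟨r₂, h₂⟩ := ih (fun d hd => hB d (List.mem_cons_of_mem _ hd))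
      ((E.map fun e => some (p.bit d e)).reverse ++ o) r₁
    have h := h₁.trans h₂
    refine ⟨r₂, ReachesWithin.mono (by simpa using h) ?_⟩
    have hd := hB d List.mem_cons_self
    have := Nat.mul_le_mul_left E.length (Nat.add_le_add_right hd 2)
    have := Nat.add_one_mul D.length (3 * B + 2 * (words E).length + E.length * (B + 2) + 6)
    rw [List.length_cons]
    omega

/-- Every word contains exactly one tag, so counting tags counts descriptors. -/
theorem countP_words (f : τ → Bool) (D : List (τ × List α)) :
    (words D).countP (fun x => (tag? (some x)).any f) = D.countP fun d => f d.1 := by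
  induction D with
  | nil => rfl
  | cons d D ih =>
    have h : (List.map (Sum.inr : α → τ ⊕ α) d.2).countP (fun x => (tag? (some x)).any f) = 0 := by
      simp [List.countP_eq_zero]
    simp only [words_cons, List.countP_cons, List.countP_append, ih, h, zero_add]
    rfl

/-- The machine writes its output within polynomial time. -/
theorem yields_output [Fintype τ] [Fintype α] (D : List (τ × List α)) (B : ℕ)
    (hB : ∀ d ∈ D, d.2.length ≤ B) :
    (p.machine t x₀ a₀).Yields
      (D.length * (3 * B + 2 * (words D).length + D.length * (B + 2) + 6) +
        3 * (words D).length + 5) (words D) (p.output t D).reverse := by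
  have h₁ := p.reach_countSome t x₀ a₀ (words D) [] [] [] [] [] (encodeUnary t).reverse
    (Reg.init τ α)
  have h₂ := h₁.trans (p.reach_countAll t x₀ a₀ _ _ _ _ _ _ _ _)
  obtain ⟨r, h₃⟩ := p.reach_rows t x₀ a₀ D D B hB
    (encodeUnary t ++ encodeUnary (D.countP fun d => p.counted d.1) ++
      encodeUnary D.length).reverse (Reg.init τ α)
  have hc : (words D).countP (fun x => (tag? (some x)).isSome) = D.length := by
    have := countP_words (fun _ : τ => true) D
    simpa [Option.any_true] using this
  simp only [List.append_nil, List.reverse_reverse, List.countP_reverse, countP_words, hc] at h₂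
  have e₁ : none :: (List.replicate D.length (some true) ++ none ::
      (List.replicate (List.countP (fun d => p.counted d.1) D) (some true) ++
        (encodeUnary t).reverse)) =
      (encodeUnary t ++ encodeUnary (D.countP fun d => p.counted d.1) ++
        encodeUnary D.length).reverse := by
    simp [encodeUnary]
  rw [e₁] at h₂
  have h₄ := (h₂.trans h₃).trans (p.reaches_finish t x₀ a₀ _ _ _ _ _ _ _ _)
  have e₂ : ∀ w : List (τ ⊕ α), (Function.update (fun _ => []) Stack.inp w : ∀ k, List (Alph τ α k)) =
      stk w [] [] [] [] [] [] := fun w => by funext k; cases k <;> rfl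
  have e₃ : ∀ w : List (Option Bool), (Function.update (fun _ => []) Stack.out w : ∀ k, List (Alph τ α k)) =
      stk [] [] [] [] [] [] w := fun w => by funext k; cases k <;> rfl
  have h₅ := ReachesWithin.head (f := TM2.step (p.prog t x₀ a₀))
    (a := ⟨some .start, Reg.init τ α, stk (words D) [] [] [] [] [] []⟩) (by simp [prog]) h₄
  rw [← List.reverse_append, ← e₂, ← e₃] at h₅
  refine ReachesWithin.mono (f := (p.machine t x₀ a₀).step) h₅ ?_
  simp
  omega

end PairTest

open Turing

/-! ### A machine that turns a formula into a list of descriptors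

Variables and clauses are described by vectors with one entry for each variable, the entries of a
clause telling which of the two literals of the variable occur in it. -/

namespace VectorMachine

open PairTest TM2.Stmt

/-- Add a literal with the given sign to an entry. -/
def mark : Bool → Bool × Bool → Bool × Bool
  | true, s => (true, s.2)
  | false, s => (s.1, true)

/-- The vector of a clause. -/
def clauseVec {N : ℕ} (c : List (Fin N × Bool)) : List (Bool × Bool) :=
  c.foldl (fun v l => v.modify l.1 (mark l.2)) (List.replicate N (false, false))

/-- The vector with a single nontrivial entry, preceded by `a` and followed by `b` trivial ones. -/
def unitVec (a b : ℕ) : List (Bool × Bool) :=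
  List.replicate a (false, false) ++ (true, true) :: List.replicate b (false, false)

/-- The tags in use. -/
structure Tags (τ : Type) where
  lit : Bool → τ
  cl : Bool → τ
  tail : List τ

variable {τ : Type} (g : Tags τ)

/-- The descriptors of the literals with vectors from `unitVec a b` up to `unitVec (a + b) 0`. -/
def litDescs : ℕ → ℕ → List (τ × List (Bool × Bool))
  | a, 0 => [(g.lit true, unitVec a 0), (g.lit false, unitVec a 0)]
  | a, b + 1 =>
    (g.lit true, unitVec a (b + 1)) :: (g.lit false, unitVec a (b + 1)) :: litDescs (a + 1) b

/-- The two descriptors of a clause. -/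
def clauseDescs {N : ℕ} (c : List (Fin N × Bool)) : List (τ × List (Bool × Bool)) :=
  [(g.cl true, (clauseVec c).reverse), (g.cl false, (clauseVec c).reverse)]

/-- The descriptors of all literals of a formula in `N` variables. -/
def allLitDescs : ℕ → List (τ × List (Bool × Bool))
  | 0 => []
  | N + 1 => litDescs g 0 N

/-- The descriptors for a formula. -/
def descs (F : CNFFormula) : List (τ × List (Bool × Bool)) :=
  allLitDescs g F.numVars ++ F.clauses.flatMap (clauseDescs g) ++ g.tail.map fun x => (x, [])

/-- The stacks: input, the current vector, two work copies of it, and the output. -/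
inductive Stack
  | inp | vec | rev | dup | out
  deriving DecidableEq

instance : Fintype Stack := ⟨{.inp, .vec, .rev, .dup, .out}, fun x => by cases x <;> simp⟩

/-- The labels of the program. -/
inductive Label
  | init | copy | emit | emitDup | clause | walk | back | finish
  deriving DecidableEq

instance : Fintype Label :=
  ⟨{.init, .copy, .emit, .emitDup, .clause, .walk, .back, .finish}, fun x => by cases x <;> simp⟩

/-- The stack alphabets. -/
abbrev Alph (τ : Type) : Stack → Type
  | .inp => Option Bool
  | .vec | .rev | .dup => Bool × Bool
  | .out => τ ⊕ (Bool × Bool)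

/-- The registers: the last letter and the last entry read, the carry of the shift, whether the
current vector belongs to a literal, and the sign of the current literal of a clause. -/
structure Reg where
  chr : Option (Option Bool)
  ent : Option (Bool × Bool)
  carry : Bool
  isLit : Bool
  sign : Bool

/-- The registers as a tuple. -/
def Reg.equiv : Reg ≃ Option (Option Bool) × Option (Bool × Bool) × Bool × Bool × Bool where
  toFun r := (r.chr, r.ent, r.carry, r.isLit, r.sign)
  invFun x := ⟨x.1, x.2.1, x.2.2.1, x.2.2.2.1, x.2.2.2.2⟩
  left_inv _ := rfl
  right_inv _ := rfl

instance : Fintype Reg := Fintype.ofEquiv _ Reg.equiv.symm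

/-- The initial registers. -/
def Reg.start : Reg := ⟨none, none, true, true, false⟩

/-- The entry last read. -/
def Reg.entry (r : Reg) : Bool × Bool := r.ent.getD (false, false)

/-- The bit last read, if any. -/
def Reg.bit? (r : Reg) : Option Bool := r.chr.join

/-- The program. -/
def prog : Label → TM2.Stmt (Alph τ) Label Reg
  | .init => pop .inp (fun r a => { r with chr := a }) <|
      branch (fun r => r.bit?.isSome)
        (push .vec (fun r => (r.carry, r.carry)) <| load (fun r => { r with carry := false }) <|
          goto fun _ => .init)
        (branch (fun r => r.carry)
          (load (fun r => { r with isLit := false }) (goto fun _ => .clause))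
          (push .out (fun _ => Sum.inl (g.lit true)) (goto fun _ => .copy)))
  | .copy => pop .vec (fun r a => { r with ent := a }) <|
      branch (fun r => r.ent.isSome)
        (push .rev Reg.entry <| push .dup Reg.entry <| goto fun _ => .copy)
        (goto fun _ => .emit)
  | .emit => pop .rev (fun r a => { r with ent := a }) <|
      branch (fun r => r.ent.isSome)
        (push .out (fun r => Sum.inr r.entry) <|
          push .vec (fun r => (r.isLit && r.carry, r.isLit && r.carry)) <|
          load (fun r => { r with carry := r.entry.1 }) <| goto fun _ => .emit)
        (push .out (fun r => Sum.inl (if r.isLit then g.lit false else g.cl false))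
          (goto fun _ => .emitDup))
  | .emitDup => pop .dup (fun r a => { r with ent := a }) <|
      branch (fun r => r.ent.isSome)
        (push .out (fun r => Sum.inr r.entry) (goto fun _ => .emitDup))
        (branch (fun r => r.isLit && !r.carry)
          (push .out (fun _ => Sum.inl (g.lit true)) (goto fun _ => .copy))
          (load (fun r => { r with isLit := false }) (goto fun _ => .clause)))
  | .clause => pop .inp (fun r a => { r with chr := a }) <|
      branch (fun r => r.chr.isSome)
        (branch (fun r => r.bit?.isSome)
          (load (fun r => { r with sign := r.bit?.getD false }) (goto fun _ => .walk))
          (push .out (fun _ => Sum.inl (g.cl true)) (goto fun _ => .copy)))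
        (goto fun _ => .finish)
  | .walk => pop .inp (fun r a => { r with chr := a }) <|
      branch (fun r => r.bit?.isSome)
        (pop .vec (fun r a => { r with ent := a }) <| push .dup Reg.entry <| goto fun _ => .walk)
        (pop .vec (fun r a => { r with ent := a }) <| push .vec (fun r => mark r.sign r.entry) <|
          goto fun _ => .back)
  | .back => pop .dup (fun r a => { r with ent := a }) <|
      branch (fun r => r.ent.isSome)
        (push .vec Reg.entry (goto fun _ => .back))
        (goto fun _ => .clause)
  | .finish => pop .vec (fun r a => { r with ent := a }) <|
      branch (fun r => r.ent.isSome) (goto fun _ => .finish)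
        (pushList .out (g.tail.map Sum.inl) <| load (fun _ => Reg.start) halt)

/-- The machine. -/
def machine : FinTM2 where
  K := Stack
  k₀ := .inp
  k₁ := .out
  Γ := Alph τ
  Λ := Label
  main := .init
  σ := Reg
  initialState := Reg.start
  Γk₀Fin := inferInstanceAs (Fintype (Option Bool))
  m := prog g

/-- The stacks with the given contents. -/
def stk (inp : List (Option Bool)) (vec rev dup : List (Bool × Bool))
    (out : List (τ ⊕ (Bool × Bool))) : ∀ k, List (Alph τ k)
  | .inp => inp
  | .vec => vec
  | .rev => rev
  | .dup => dup
  | .out => out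

section
variable (i : List (Option Bool)) (v r d : List (Bool × Bool)) (o : List (τ ⊕ (Bool × Bool)))

@[simp] theorem stk_inp : stk i v r d o .inp = i := rfl
@[simp] theorem stk_vec : stk i v r d o .vec = v := rfl
@[simp] theorem stk_rev : stk i v r d o .rev = r := rfl
@[simp] theorem stk_dup : stk i v r d o .dup = d := rfl
@[simp] theorem stk_out : stk i v r d o .out = o := rfl

@[simp] theorem update_stk_inp (x) : Function.update (stk i v r d o) .inp x = stk x v r d o := by
  funext k; cases k <;> rfl
@[simp] theorem update_stk_vec (x) : Function.update (stk i v r d o) .vec x = stk i x r d o := by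
  funext k; cases k <;> rfl
@[simp] theorem update_stk_rev (x) : Function.update (stk i v r d o) .rev x = stk i v x d o := by
  funext k; cases k <;> rfl
@[simp] theorem update_stk_dup (x) : Function.update (stk i v r d o) .dup x = stk i v r x o := by
  funext k; cases k <;> rfl
@[simp] theorem update_stk_out (x) : Function.update (stk i v r d o) .out x = stk i v r d x := by
  funext k; cases k <;> rfl

end

/-! ### Runs of the program that writes the descriptors -/

/-- Bounded reachability for the program. -/
abbrev Reach (T : ℕ) (l : Label) (r : Reg) (S : ∀ k, List (Alph τ k)) (l' : Label)
    (r' : Reg) (S' : ∀ k, List (Alph τ k)) : Prop :=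
  ReachesWithin (TM2.step (prog g)) T ⟨some l, r, S⟩ ⟨some l', r', S'⟩

theorem reach_copy (v : List (Bool × Bool)) (i d d' o) (r : Reg) :
    Reach g (v.length + 1) .copy r (stk i v d d' o) .emit { r with ent := none }
      (stk i [] (v.reverse ++ d) (v.reverse ++ d') o) := by
  induction v generalizing d d' r with
  | nil => exact .single (by simp [prog])
  | cons x v ih =>
    have h := ih (x :: d) (x :: d') { r with ent := some x }
    refine .head ?_ (by simpa using h)
    simp [prog, Reg.entry]

/-- Shift a vector by one position, with the given carry. -/
def shift : Bool → List (Bool × Bool) → List (Bool × Bool)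
  | _, [] => []
  | c, x :: v => (c, c) :: shift x.1 v

/-- The carry that results from a shift. -/
def carryOut : Bool → List (Bool × Bool) → Bool
  | c, [] => c
  | _, x :: v => carryOut x.1 v

/-- While a unit vector is written, its shift by one position is rebuilt on `vec`; thus the next
literal is prepared without a counter. -/
theorem reach_emit_lit (w : List (Bool × Bool)) (i v d o) (r : Reg) (hr : r.isLit = true) :
    Reach g (w.length + 1) .emit r (stk i v w d o) .emitDup
      { r with ent := none, carry := carryOut r.carry w }
      (stk i ((shift r.carry w).reverse ++ v) [] d
        (Sum.inl (g.lit false) :: ((w.map Sum.inr).reverse ++ o))) := by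
  induction w generalizing v o r with
  | nil => exact .single (by simp [prog, hr, carryOut, shift])
  | cons x w ih =>
    have h := ih ((r.carry, r.carry) :: v) (Sum.inr x :: o)
      { r with ent := some x, carry := x.1 } hr
    refine .head ?_ (by simpa [carryOut, shift] using h)
    simp [prog, hr, Reg.entry]

/-- Here trivial entries are pushed in place of the shift, which resets `vec` for the next clause.
-/
theorem reach_emit_clause (w : List (Bool × Bool)) (i v d o) (r : Reg) (hr : r.isLit = false) :
    ∃ r', r'.isLit = false ∧ Reach g (w.length + 1) .emit r (stk i v w d o) .emitDup r'
      (stk i (List.replicate w.length (false, false) ++ v) [] d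
        (Sum.inl (g.cl false) :: ((w.map Sum.inr).reverse ++ o))) := by
  induction w generalizing v o r with
  | nil => exact ⟨{ r with ent := none }, hr, .single (by simp [prog, hr])⟩
  | cons x w ih =>
    obtain ⟨r', hr', h⟩ := ih ((false, false) :: v) (Sum.inr x :: o)
      { r with ent := some x, carry := x.1 } hr
    refine ⟨r', hr', .head ?_ (by simpa [List.replicate_succ'] using h)⟩
    simp [prog, hr, Reg.entry]

/-- What happens after both copies of a vector have been written. -/
theorem reach_emitDup_loop (w : List (Bool × Bool)) (i v d o) (r : Reg)
    {c : TM2.Cfg (Alph τ) Label Reg}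
    (hc : TM2.step (prog g) ⟨some .emitDup, { r with ent := none },
      stk i v d [] ((w.map Sum.inr).reverse ++ o)⟩ = some c) :
    ReachesWithin (TM2.step (prog g)) (w.length + 1) ⟨some .emitDup, r, stk i v d w o⟩ c := by
  induction w generalizing o r with
  | nil =>
    refine .single (Eq.trans ?_ hc)
    simp [prog]
  | cons x w ih =>
    refine .head (b := ⟨some .emitDup, { r with ent := some x }, stk i v d w (Sum.inr x :: o)⟩)
      ?_ (ih _ _ (Eq.trans ?_ hc))
    · simp [prog, Reg.entry]
    · simp

theorem reach_emitDup_clause (w : List (Bool × Bool)) (i v d o) (r : Reg)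
    (hr : r.isLit = false ∨ r.carry = true) :
    Reach g (w.length + 1) .emitDup r (stk i v d w o) .clause
      { r with ent := none, isLit := false } (stk i v d [] ((w.map Sum.inr).reverse ++ o)) := by
  refine reach_emitDup_loop g w i v d o r ?_
  rcases hr with hr | hr <;> simp [prog, hr]

theorem reach_emitDup_lit (w : List (Bool × Bool)) (i v d o) (r : Reg)
    (hr : r.isLit = true) (hr' : r.carry = false) :
    Reach g (w.length + 1) .emitDup r (stk i v d w o) .copy
      { r with ent := none }
      (stk i v d [] (Sum.inl (g.lit true) :: ((w.map Sum.inr).reverse ++ o))) := by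
  refine reach_emitDup_loop g w i v d o r ?_
  simp [prog, hr, hr']

theorem shift_unitVec_succ (a b : ℕ) : shift false (unitVec a (b + 1)) = unitVec (a + 1) b := by
  induction a with
  | zero =>
    have : ∀ c b, shift c (List.replicate (b + 1) (false, false)) =
        (c, c) :: List.replicate b (false, false) := by
      intro c b
      induction b generalizing c with
      | zero => rfl
      | succ b ih => rw [List.replicate_succ, shift, ih, ← List.replicate_succ]
    simp [unitVec, shift, this]
  | succ a ih =>
    have h : ∀ a b, unitVec (a + 1) b = (false, false) :: unitVec a b := fun a b => by
      simp [unitVec, List.replicate_succ]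
    rw [h, shift, ih, ← h]

/-- The last shift drops the mark, leaving the blank vector from which the first clause starts. The
carry is then true, and this is the signal to stop writing literals. -/
theorem shift_unitVec_zero (a : ℕ) :
    shift false (unitVec a 0) = List.replicate (a + 1) (false, false) := by
  induction a with
  | zero => rfl
  | succ a ih =>
    have h : unitVec (a + 1) 0 = (false, false) :: unitVec a 0 := by
      simp [unitVec, List.replicate_succ]
    rw [h, shift, ih, ← List.replicate_succ]

theorem carryOut_append (c : Bool) (v w : List (Bool × Bool)) :
    carryOut c (v ++ w) = carryOut (carryOut c v) w := by
  induction v generalizing c with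
  | nil => rfl
  | cons x v ih => exact ih _

theorem carryOut_replicate (c : Bool) (b : ℕ) :
    carryOut c (List.replicate (b + 1) (false, false)) = false := by
  induction b generalizing c with
  | zero => rfl
  | succ b ih => exact ih false

theorem carryOut_unitVec_succ (c : Bool) (a b : ℕ) : carryOut c (unitVec a (b + 1)) = false := by
  rw [unitVec, carryOut_append, carryOut, carryOut_replicate]

theorem carryOut_unitVec_zero (c : Bool) (a : ℕ) : carryOut c (unitVec a 0) = true := by
  rw [unitVec, carryOut_append]
  rfl

@[simp]
theorem length_unitVec (a b : ℕ) : (unitVec a b).length = a + b + 1 := by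
  simp [unitVec]; omega

/-- Writing the descriptors of all literals. -/
theorem reach_lits (a b : ℕ) (i o) (r : Reg) (hr : r.isLit = true) (hc : r.carry = false) :
    ∃ r', r'.isLit = false ∧ Reach g ((b + 1) * (3 * (a + b + 2))) .copy r
      (stk i (unitVec a b).reverse [] [] (Sum.inl (g.lit true) :: o))
      .clause r' (stk i (List.replicate (a + b + 1) (false, false)) [] []
        ((words (litDescs g a b)).reverse ++ o)) := by
  induction b generalizing a o r with
  | zero =>
    have h₁ := reach_copy g (unitVec a 0).reverse i [] []
      (Sum.inl (g.lit true) :: o) r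
    have h₂ := h₁.trans (reach_emit_lit g _ _ _ _ _ _ hr)
    simp only [hc, List.append_nil, List.reverse_reverse, shift_unitVec_zero,
      carryOut_unitVec_zero, List.reverse_replicate] at h₂
    have h₃ := h₂.trans (reach_emitDup_clause g _ _ _ _ _ _ (Or.inr rfl))
    refine ⟨_, rfl, ReachesWithin.mono (by simpa [litDescs] using h₃) ?_⟩
    omega
  | succ b ih =>
    have h₁ := reach_copy g (unitVec a (b + 1)).reverse i [] []
      (Sum.inl (g.lit true) :: o) r
    have h₂ := h₁.trans (reach_emit_lit g _ _ _ _ _ _ hr)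
    simp only [hc, List.append_nil, List.reverse_reverse, shift_unitVec_succ,
      carryOut_unitVec_succ] at h₂
    have h₃ := h₂.trans (reach_emitDup_lit g _ _ _ _ _ _ hr rfl)
    obtain ⟨r', hr', h₄⟩ := ih (a + 1) ((unitVec a (b + 1)).map Sum.inr |>.reverse |>.append
      (Sum.inl (g.lit false) :: (((unitVec a (b + 1)).map Sum.inr).reverse ++
        Sum.inl (g.lit true) :: o))) { r with ent := none, carry := false } hr rfl
    have h₅ := h₃.trans h₄
    refine ⟨r', hr', ReachesWithin.mono
      (by simpa [litDescs, show a + 1 + b + 1 = a + (b + 1) + 1 by omega] using h₅) ?_⟩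
    ring_nf
    omega

/-- This describes the loop after the first digit, when `carry` has been cleared; in the application
`v` is the single marked entry pushed for that digit. -/
theorem reach_init (N : ℕ) (i v o) (r : Reg) (hc : r.carry = false) :
    Reach g (N + 1) .init r (stk (encodeUnary N ++ i) v [] [] o)
      .copy { r with chr := some none }
      (stk i (List.replicate N (false, false) ++ v) [] [] (Sum.inl (g.lit true) :: o)) := by
  induction N generalizing v r with
  | zero => exact .single (by simp [prog, encodeUnary, Reg.bit?, hc])
  | succ N ih =>
    have h := ih ((false, false) :: v) { r with chr := some (some true), carry := false } rfl
    refine .head (b := ⟨some .init, { r with chr := some (some true), carry := false },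
      stk (encodeUnary N ++ i) ((false, false) :: v) [] [] o⟩) ?_ ?_
    · simp [prog, encodeUnary, Reg.bit?, List.replicate_succ, hc]
    · simpa [List.replicate_succ', hc] using h

/-- Reading the number of variables and writing the descriptors of all literals. -/
theorem reach_allLits (N : ℕ) (i) :
    ∃ r', r'.isLit = false ∧ Reach g (N + 1 + N * (3 * (N + 1))) .init Reg.start
      (stk (encodeUnary N ++ i) [] [] [] [])
      .clause r' (stk i (List.replicate N (false, false)) [] []
        (words (allLitDescs g N)).reverse) := by
  cases N with
  | zero =>
    -- Without variables `carry` keeps its initial value `true`, by which the program knows that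
    -- there are no literals to write.
    refine ⟨{ Reg.start with chr := some none, isLit := false }, rfl,
      ReachesWithin.mono (T := 1) (.single ?_) (by simp)⟩
    simp [prog, encodeUnary, Reg.bit?, Reg.start, allLitDescs]
  | succ N =>
    have h₁ := reach_init g N i [(true, true)] []
      { Reg.start with chr := some (some true), carry := false } rfl
    have e : List.replicate N (false, false) ++ [(true, true)] = (unitVec 0 N).reverse := by
      simp [unitVec]
    rw [e] at h₁
    obtain ⟨r', hr', h₂⟩ := reach_lits g 0 N i []
      { Reg.start with chr := some none, carry := false } rfl rfl
    have h₃ := h₁.trans h₂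
    simp only [List.append_nil, zero_add] at h₃
    refine ⟨r', hr', ReachesWithin.mono (.head ?_ h₃) ?_⟩
    · simp [prog, encodeUnary, Reg.bit?, Reg.start, List.replicate_succ]
    · ring_nf
      omega

theorem reach_back (w : List (Bool × Bool)) (i v d o) (r : Reg) :
    Reach g (w.length + 1) .back r (stk i v d w o) .clause { r with ent := none }
      (stk i (w.reverse ++ v) d [] o) := by
  induction w generalizing v r with
  | nil => exact .single (by simp [prog])
  | cons x w ih =>
    have h := ih (x :: v) { r with ent := some x }
    refine .head ?_ (by simpa using h)
    simp [prog, Reg.entry]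

/-- The unary index is matched digit by digit with the entries moved to `dup`; at the separator the
next entry is marked, and `dup` is moved back. -/
theorem reach_walk (l l' w : List (Bool × Bool)) (x : Bool × Bool) (i o) (r : Reg)
    (hr : r.isLit = false) :
    ∃ r', r'.isLit = false ∧ Reach g (2 * l.length + w.length + 2) .walk r
      (stk (encodeUnary l.length ++ i) (l ++ x :: l') [] w o) .clause r'
      (stk i (w.reverse ++ (l ++ mark r.sign x :: l')) [] [] o) := by
  induction l generalizing w r with
  | nil =>
    have h := reach_back g w i (mark r.sign x :: l') [] o { r with chr := some none, ent := some x }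
    refine ⟨_, ?_, ReachesWithin.mono (.head ?_ h) ?_⟩
    · exact hr
    · simp [prog, encodeUnary, Reg.bit?, Reg.entry]
    · simp
  | cons y l ih =>
    obtain ⟨r', hr', h⟩ := ih (y :: w) { r with chr := some (some true), ent := some y } hr
    refine ⟨r', hr', ReachesWithin.mono (.head (b := ⟨some .walk,
      { r with chr := some (some true), ent := some y },
      stk (encodeUnary l.length ++ i) (l ++ x :: l') [] (y :: w) o⟩) ?_ (by simpa using h)) ?_⟩
    · simp [prog, encodeUnary, Reg.bit?, Reg.entry, List.replicate_succ]
    · simp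
      omega

/-- Reading a literal of a clause. -/
theorem reach_literal (v : List (Bool × Bool)) (k : ℕ) (b : Bool) (hk : k < v.length) (i o)
    (r : Reg) (hr : r.isLit = false) :
    ∃ r', r'.isLit = false ∧ Reach g (2 * (some b :: encodeUnary k).length) .clause r
      (stk (some b :: encodeUnary k ++ i) v [] [] o) .clause r'
      (stk i (v.modify k (mark b)) [] [] o) := by
  obtain ⟨r', hr', h⟩ := reach_walk g (v.take k) (v.drop (k + 1)) [] v[k] i o
    { r with chr := some (some b), sign := b } hr
  rw [List.length_take_of_le hk.le] at h
  refine ⟨r', hr', ReachesWithin.mono (.head (b := ⟨some .walk,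
      { r with chr := some (some b), sign := b },
      stk (encodeUnary k ++ i) v [] [] o⟩) ?_ ?_) (T := 2 * k + 2 + 1) ?_⟩
  · simp [prog, Reg.bit?]
  · rw [List.modify_eq_take_cons_drop hk]
    simpa using h
  · simp [encodeUnary]
    omega

/-- A clause as a string, without the closing separator. -/
def litString {N : ℕ} (c : List (Fin N × Bool)) : List (Option Bool) :=
  c.flatMap fun l => some l.2 :: encodeUnary l.1

theorem reach_literals {N : ℕ} (c : List (Fin N × Bool)) (v : List (Bool × Bool))
    (hv : v.length = N) (i o) (r : Reg) (hr : r.isLit = false) :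
    ∃ r', r'.isLit = false ∧ Reach g (2 * (litString c).length) .clause r
      (stk (litString c ++ i) v [] [] o) .clause r'
      (stk i (c.foldl (fun v l => v.modify l.1 (mark l.2)) v) [] [] o) := by
  induction c generalizing v r with
  | nil => exact ⟨r, hr, ReachesWithin.refl _ _⟩
  | cons l c ih =>
    obtain ⟨r₁, hr₁, h₁⟩ := reach_literal g v l.1 l.2 (hv ▸ l.1.2) (litString c ++ i) o r hr
    obtain ⟨r₂, hr₂, h₂⟩ := ih (v.modify l.1 (mark l.2)) (by simpa using hv) r₁ hr₁
    have h₃ := h₁.trans h₂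
    refine ⟨r₂, hr₂, ReachesWithin.mono (by simpa [litString] using h₃) ?_⟩
    simp [litString]
    omega

theorem length_foldl_modify {N : ℕ} (c : List (Fin N × Bool)) (v : List (Bool × Bool)) :
    (c.foldl (fun v l => v.modify l.1 (mark l.2)) v).length = v.length := by
  induction c generalizing v with
  | nil => rfl
  | cons l c ih => rw [List.foldl_cons, ih, List.length_modify]

@[simp]
theorem length_clauseVec {N : ℕ} (c : List (Fin N × Bool)) : (clauseVec c).length = N := by
  rw [clauseVec, length_foldl_modify, List.length_replicate]

/-- Reading a clause and writing its two descriptors. -/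
theorem reach_clause {N : ℕ} (c : List (Fin N × Bool)) (i o) (r : Reg) (hr : r.isLit = false) :
    ∃ r', r'.isLit = false ∧ Reach g (2 * (litString c).length + 3 * N + 4) .clause r
      (stk (litString c ++ none :: i) (List.replicate N (false, false)) [] [] o) .clause r'
      (stk i (List.replicate N (false, false)) [] [] ((words (clauseDescs g c)).reverse ++ o)) := by
  obtain ⟨r₁, hr₁, h₁⟩ := reach_literals g c (List.replicate N (false, false)) (by simp)
    (none :: i) o r hr
  have h₂ := reach_copy g (clauseVec c) i [] [] (Sum.inl (g.cl true) :: o)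
    { r₁ with chr := some none }
  obtain ⟨r₃, hr₃, h₃⟩ := reach_emit_clause g ((clauseVec c).reverse ++ []) i []
    ((clauseVec c).reverse ++ []) (Sum.inl (g.cl true) :: o)
    { r₁ with chr := some none, ent := none } hr₁
  have h₄ := (h₂.trans h₃).trans (reach_emitDup_clause g _ _ _ _ _ _ (Or.inl hr₃))
  have h₅ := h₁.trans (.head (by simp [prog, Reg.bit?, clauseVec]) h₄)
  refine ⟨_, rfl, ReachesWithin.mono (by simpa [clauseDescs] using h₅) ?_⟩
  omega

theorem reach_clauses {N : ℕ} (cs : List (List (Fin N × Bool))) (o) (r : Reg)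
    (hr : r.isLit = false) :
    ∃ r', Reach g (2 * (cs.flatMap fun c => litString c ++ [none]).length +
        cs.length * (3 * N + 4) + 1) .clause r
      (stk (cs.flatMap fun c => litString c ++ [none]) (List.replicate N (false, false)) [] [] o)
      .finish r' (stk [] (List.replicate N (false, false)) [] []
        ((words (cs.flatMap (clauseDescs g))).reverse ++ o)) := by
  induction cs generalizing o r with
  | nil =>
    exact ⟨{ r with chr := none }, ReachesWithin.mono (T := 1) (.single (by simp [prog])) (by simp)⟩
  | cons c cs ih =>
    obtain ⟨r₁, hr₁, h₁⟩ := reach_clause g c (cs.flatMap fun c => litString c ++ [none]) o r hr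
    obtain ⟨r₂, h₂⟩ := ih ((words (clauseDescs g c)).reverse ++ o) r₁ hr₁
    have h₃ := h₁.trans h₂
    have e : words (clauseDescs g c ++ cs.flatMap (clauseDescs g)) =
        words (clauseDescs g c) ++ words (cs.flatMap (clauseDescs g)) := by
      simp [words]
    refine ⟨r₂, ReachesWithin.mono (by simpa [e] using h₃) ?_⟩
    simp
    ring_nf
    omega

theorem reaches_finish (v : List (Bool × Bool)) (o) (r : Reg) :
    ReachesWithin (TM2.step (prog g)) (v.length + 1) ⟨some .finish, r, stk [] v [] [] o⟩
      ⟨none, Reg.start, stk [] [] [] [] ((words (g.tail.map fun x => (x, []))).reverse ++ o)⟩ := by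
  induction v generalizing r with
  | nil =>
    refine .single ?_
    have e : words (g.tail.map fun x => (x, ([] : List (Bool × Bool)))) = g.tail.map Sum.inl := by
      induction g.tail with
      | nil => rfl
      | cons x l ih => simp [ih]
    simp [prog, e]
  | cons x v ih =>
    refine .head ?_ (ih { r with ent := some x })
    simp [prog]

/-- The machine writes the descriptors of the given formula within polynomial time. -/
theorem yields_words (F : CNFFormula) :
    (machine g).Yields (3 * F.numVars * F.numVars + 5 * F.numVars + 2 * F.encode.length +
        F.clauses.length * (3 * F.numVars + 4) + 3) F.encode (words (descs g F)).reverse := by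
  obtain ⟨r₁, hr₁, h₁⟩ := reach_allLits g F.numVars
    (F.clauses.flatMap fun c => litString c ++ [none])
  obtain ⟨r₂, h₂⟩ := reach_clauses g F.clauses (words (allLitDescs g F.numVars)).reverse r₁ hr₁
  have h₃ := (h₁.trans h₂).trans (reaches_finish g _ _ r₂)
  have e₁ : encodeUnary F.numVars ++ (F.clauses.flatMap fun c => litString c ++ [none]) =
    F.encode := rfl
  have e₂ : (words (g.tail.map fun x => (x, []))).reverse ++
      ((words (F.clauses.flatMap (clauseDescs g))).reverse ++
        (words (allLitDescs g F.numVars)).reverse) = (words (descs g F)).reverse := by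
    simp [descs, words]
  have e₃ : ∀ w : List (Option Bool), (Function.update (fun _ => []) Stack.inp w :
      ∀ k, List (Alph τ k)) = stk w [] [] [] [] := fun w => by funext k; cases k <;> rfl
  have e₄ : ∀ w, (Function.update (fun _ => []) Stack.out w : ∀ k, List (Alph τ k)) =
      stk [] [] [] [] w := fun w => by funext k; cases k <;> rfl
  rw [e₁, e₂, ← e₃, ← e₄] at h₃
  refine ReachesWithin.mono (f := (machine g).step) h₃ ?_
  have : (F.clauses.flatMap fun c => litString c ++ [none]).length ≤ F.encode.length := by
    rw [← e₁, List.length_append]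
    omega
  simp only [List.length_replicate]
  ring_nf
  omega

end VectorMachine

/-! ### Robust and hereditary 2-clubs in terms of common neighbours -/

section Clubs

variable {V : Type} (G : SimpleGraph V) (S : Set V)

/-- `u` and `v` have at least `q` common neighbours within `S`. -/
def HasCommonNeighbors (q : ℕ) (u v : V) : Prop :=
  ∃ C : Finset V, q ≤ C.card ∧ ∀ w ∈ C, w ∈ S ∧ G.Adj u w ∧ G.Adj w v

/-- Any two vertices of `S` are adjacent with `q` common neighbours within `S`, or have `q + 1`
common neighbours within `S`. -/
def IsTightlyLinked (q : ℕ) : Prop :=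
  ∀ u ∈ S, ∀ v ∈ S, u ≠ v →
    (G.Adj u v ∧ HasCommonNeighbors G S q u v) ∨ HasCommonNeighbors G S (q + 1) u v

/-- Any two non-adjacent vertices of `S` have `q + 1` common neighbours within `S`. -/
def IsLooselyLinked (q : ℕ) : Prop :=
  ∀ u ∈ S, ∀ v ∈ S, u ≠ v → ¬ G.Adj u v → HasCommonNeighbors G S (q + 1) u v

variable {G S}

/-- A walk of length at most two between distinct non-adjacent vertices has a middle vertex. -/
theorem SimpleGraph.Walk.exists_middle {V : Type} {G : SimpleGraph V} {u v : V} (p : G.Walk u v)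
    (hp : p.length ≤ 2) (huv : u ≠ v) (hadj : ¬ G.Adj u v) :
    ∃ w ∈ p.support, G.Adj u w ∧ G.Adj w v := by
  match p, hp with
  | .nil, _ => exact absurd rfl huv
  | .cons h .nil, _ => exact absurd h hadj
  | .cons h (.cons h' .nil), _ => exact ⟨_, by simp, h, h'⟩
  | .cons _ (.cons _ (.cons _ _)), hp => simp at hp

/-- The path through the given middle vertex, or the edge if there is none. -/
theorem exists_path_of_middle {H : SimpleGraph V} {u v : V} (huv : u ≠ v) (m : Option V)
    (hm : m.elim (H.Adj u v) fun w => H.Adj u w ∧ H.Adj w v) :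
    ∃ P : H.Path u v, (P : H.Walk u v).length ≤ 2 ∧
      ∀ x, x ∈ (P : H.Walk u v).support ↔ x = u ∨ x = v ∨ m = some x := by
  cases m with
  | none =>
    have hm' : H.Adj u v := hm
    exact ⟨SimpleGraph.Path.singleton hm', by simp [SimpleGraph.Path.singleton],
      by simp [SimpleGraph.Path.singleton]⟩
  | some w =>
    obtain ⟨h, h'⟩ := hm
    refine ⟨⟨.cons h (.cons h' .nil), ?_⟩, by simp, ?_⟩
    · simp [SimpleGraph.Walk.cons_isPath_iff, h.ne, h'.ne, huv]
    · intro x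
      simp
      grind

/-- A middle vertex differs from both ends, so it is determined by the support of its path, and
paths with different middles meet only at the ends. The edge has middle `none`. -/
theorem exists_paths_of_middles {H : SimpleGraph V} {u v : V} (huv : u ≠ v) {t : ℕ}
    (m : Fin t → Option V) (hinj : Function.Injective m)
    (hm : ∀ i, (m i).elim (H.Adj u v) fun w => H.Adj u w ∧ H.Adj w v) :
    ∃ P : Fin t → H.Path u v, Function.Injective P ∧
      (∀ i, (P i : H.Walk u v).length ≤ 2) ∧
      ∀ i j, i ≠ j → ∀ w, w ∈ (P i : H.Walk u v).support →
        w ∈ (P j : H.Walk u v).support → w = u ∨ w = v := by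
  choose P hlen hsupp using fun i => exists_path_of_middle huv (m i) (hm i)
  have hne : ∀ i x, m i = some x → x ≠ u ∧ x ≠ v := by
    intro i x hx
    have := hm i
    rw [hx] at this
    exact ⟨this.1.ne', this.2.ne⟩
  refine ⟨P, fun i j hij => hinj ?_, hlen, fun i j hij w hi hj => ?_⟩
  · have h : ∀ x, m i = some x ↔ m j = some x := fun x => by
      have h₁ := hsupp i x
      rw [hij, hsupp j x] at h₁
      constructor <;> intro h
      · have := hne i x h
        tauto
      · have := hne j x h
        tauto
    exact Option.ext h
  · rw [hsupp] at hi hj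
    by_contra hw
    push Not at hw
    exact hij (hinj ((by tauto : m i = some w).trans (by tauto : m j = some w).symm))

theorem HasCommonNeighbors.exists_injective {q : ℕ} {u v : V} (hu : u ∈ S) (hv : v ∈ S)
    (h : HasCommonNeighbors G S q u v) :
    ∃ f : Fin q → S, Function.Injective f ∧
      ∀ i, (G.induce S).Adj ⟨u, hu⟩ (f i) ∧ (G.induce S).Adj (f i) ⟨v, hv⟩ := by
  obtain ⟨C, hC, hC'⟩ := h
  let e := C.equivFin.symm
  refine ⟨fun i => ⟨e (Fin.castLE hC i), (hC' _ (e (Fin.castLE hC i)).2).1⟩, ?_, fun i => ?_⟩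
  · intro i j hij
    have : e (Fin.castLE hC i) = e (Fin.castLE hC j) := Subtype.ext (congrArg (Subtype.val : S → V) hij)
    exact Fin.castLE_injective hC (e.injective this)
  · exact (hC' _ (e (Fin.castLE hC i)).2).2

/-- For adjacent vertices the edge is one of the q + 1 paths, so q common neighbours suffice. -/
theorem IsTightlyLinked.isRobustTwoClub {q : ℕ} (h : IsTightlyLinked G S q) :
    IsRobustTwoClub (q + 1) G S := by
  rintro ⟨u, hu⟩ ⟨v, hv⟩ huv
  rcases h u hu v hv (fun h => huv (Subtype.ext h)) with ⟨hadj, hc⟩ | hc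
  · obtain ⟨f, hf, hf'⟩ := hc.exists_injective hu hv
    refine exists_paths_of_middles huv (Fin.cons none fun i => some (f i)) ?_ ?_
    · rw [Fin.cons_injective_iff]
      refine ⟨by simp, fun i j hij => hf (Option.some.inj hij)⟩
    · intro i
      refine Fin.cases ?_ (fun i => ?_) i
      · exact hadj
      · exact hf' i
  · obtain ⟨f, hf, hf'⟩ := hc.exists_injective hu hv
    exact exists_paths_of_middles huv (fun i => some (f i))
      (fun i j hij => hf (Option.some.inj hij)) hf'

/-- Between non-adjacent vertices every path of length at most two has a middle vertex, and
disjointness makes these distinct. -/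
theorem IsRobustTwoClub.isLooselyLinked {q : ℕ} (h : IsRobustTwoClub (q + 1) G S) :
    IsLooselyLinked G S q := by
  classical
  intro u hu v hv huv hadj
  obtain ⟨P, -, hlen, hdisj⟩ := h ⟨u, hu⟩ ⟨v, hv⟩ (fun h => huv (congrArg Subtype.val h))
  choose w hw hw' using fun i => (P i).1.exists_middle (hlen i)
    (fun h => huv (congrArg Subtype.val h)) hadj
  refine ⟨Finset.univ.image fun i => (w i : V), ?_, ?_⟩
  · rw [Finset.card_image_of_injective, Finset.card_univ, Fintype.card_fin]
    intro i j hij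
    by_contra hne
    have hij' : w i = w j := Subtype.ext hij
    rcases hdisj i j hne (w i) (hw i) (hij' ▸ hw j) with h | h
    · exact (hw' i).1.ne h.symm
    · exact (hw' i).2.ne h
  · simp only [Finset.mem_image, Finset.mem_univ, true_and, forall_exists_index]
    rintro _ i rfl
    exact ⟨(w i).2, hw' i⟩

/-- An edge survives the deletion of other vertices, and of q + 1 common neighbours at least one
survives q deletions. -/
theorem IsTightlyLinked.isHereditaryTwoClub {q : ℕ} (h : IsTightlyLinked G S q) :
    IsHereditaryTwoClub q G S := by
  intro U _ hUq
  refine SimpleGraph.ediam_le_of_edist_le ?_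
  rintro ⟨u, hu, huU⟩ ⟨v, hv, hvU⟩
  by_cases huv : u = v
  · subst huv; simp
  have key : ∀ {w : V} (hw : w ∈ S \ U), G.Adj u w → G.Adj w v →
      (G.induce (S \ U)).edist ⟨u, hu, huU⟩ ⟨v, hv, hvU⟩ ≤ 2 := by
    intro w hw h₁ h₂
    have h₁' : (G.induce (S \ U)).Adj ⟨u, hu, huU⟩ ⟨w, hw⟩ := h₁
    have h₂' : (G.induce (S \ U)).Adj ⟨w, hw⟩ ⟨v, hv, hvU⟩ := h₂
    exact (SimpleGraph.Walk.cons h₁' (.cons h₂' .nil)).edist_le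
  rcases h u hu v hv huv with ⟨hadj, -⟩ | ⟨C, hC, hC'⟩
  · have hadj' : (G.induce (S \ U)).Adj ⟨u, hu, huU⟩ ⟨v, hv, hvU⟩ := hadj
    refine (SimpleGraph.Walk.cons hadj' .nil).edist_le.trans ?_
    simp
  · obtain ⟨w, hwC, hwU⟩ := Finset.exists_mem_notMem_of_card_lt_card (s := U) (t := C) (by omega)
    exact key ⟨(hC' w hwC).1, hwU⟩ (hC' w hwC).2.1 (hC' w hwC).2.2

theorem IsHereditaryTwoClub.isLooselyLinked [Fintype V] {q : ℕ} (h : IsHereditaryTwoClub q G S) :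
    IsLooselyLinked G S q := by
  classical
  intro u hu v hv huv hadj
  let C : Finset V := Finset.univ.filter fun w => w ∈ S ∧ G.Adj u w ∧ G.Adj w v
  by_contra hcon
  have hC : C.card ≤ q := by
    by_contra hC
    -- Otherwise `C`, the set of all common neighbours, may be deleted, and no path of length two is
    -- left.
    exact hcon ⟨C, by omega, fun w hw => (Finset.mem_filter.1 hw).2⟩
  have hclub := h C (fun w hw => (Finset.mem_filter.1 hw).2.1) hC
  have huC : u ∉ C := fun hw => (Finset.mem_filter.1 hw).2.2.1.ne rfl
  have hvC : v ∉ C := fun hw => (Finset.mem_filter.1 hw).2.2.2.ne rfl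
  have hd : (G.induce (S \ C)).edist ⟨u, hu, huC⟩ ⟨v, hv, hvC⟩ ≤ 2 :=
    SimpleGraph.edist_le_ediam.trans hclub
  obtain ⟨p, hp⟩ := SimpleGraph.exists_walk_of_edist_ne_top
    (ne_top_of_le_ne_top (by simp) hd)
  obtain ⟨w, -, hw⟩ := p.exists_middle (by rw [← hp] at hd; exact_mod_cast hd)
    (fun h => huv (congrArg Subtype.val h)) hadj
  exact w.2.2 (Finset.mem_coe.2 (Finset.mem_filter.2 ⟨Finset.mem_univ _, w.2.1, hw⟩))

end Clubs

/-! ### The reduction from satisfiability -/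

/-- The kinds of vertices: literals, clause vertices, hubs and apexes. -/
inductive ClubTag (q : ℕ)
  | lit (b : Bool)
  | cl (s : Bool)
  | hub (x y : Bool)
  | apex (i : Fin q)
  deriving DecidableEq

namespace ClubTag

/-- The tags as a sum type. -/
def equiv (q : ℕ) : Bool ⊕ Bool ⊕ (Bool × Bool) ⊕ Fin q ≃ ClubTag q where
  toFun
    | .inl b => lit b
    | .inr (.inl s) => cl s
    | .inr (.inr (.inl x)) => hub x.1 x.2
    | .inr (.inr (.inr i)) => apex i
  invFun
    | lit b => .inl b
    | cl s => .inr (.inl s)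
    | hub x y => .inr (.inr (.inl (x, y)))
    | apex i => .inr (.inr (.inr i))
  left_inv x := by rcases x with _ | _ | _ | _ <;> rfl
  right_inv x := by cases x <;> rfl

instance (q : ℕ) : Fintype (ClubTag q) := Fintype.ofEquiv _ (equiv q)

/-- The tags of the vertices without vector. -/
def tail (q : ℕ) : List (ClubTag q) :=
  [hub true true, hub true false, hub false true, hub false false] ++ (List.finRange q).map apex

/-- The tags used by the machine. -/
def tags (q : ℕ) : VectorMachine.Tags (ClubTag q) := ⟨lit, cl, tail q⟩

/-- Adjacency that depends on the tags only. -/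
def base {q : ℕ} : ClubTag q → ClubTag q → Bool
  | lit b, hub x _ | hub x _, lit b => x == b
  | cl s, hub _ y | hub _ y, cl s => y == s
  | hub x y, hub x' y' => (x, y) != (x', y')
  | apex i, apex j => i != j
  | apex _, _ | _, apex _ => true
  | _, _ => false

/-- Adjacency that depends on the vectors. -/
def sym {q : ℕ} : ClubTag q → ClubTag q → Bool × Bool → Bool × Bool → Bool
  | lit b, lit b', x, y => b != b' && x != y
  | cl s, cl s', x, y => s != s' && (x != y || x == (true, true))
  | lit b, cl _, x, y | cl _, lit b, y, x => x == (true, true) && y == (b, !b)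
  | _, _, _, _ => false

/-- The adjacency test; the vertices that are not positive literals are counted. -/
def test (q : ℕ) : PairTest (ClubTag q) (Bool × Bool) :=
  ⟨base, sym, fun x => x != lit true⟩

end ClubTag

/-- The vertices of the graph for a formula with `N` variables and `m` clauses. -/
inductive ClubVertex (N m q : ℕ)
  | lit (i : Fin N) (b : Bool)
  | cl (j : Fin m) (s : Bool)
  | hub (x y : Bool)
  | apex (i : Fin q)
  deriving DecidableEq

namespace ClubVertex

/-- The list of all vertices. -/
def all (N m q : ℕ) : List (ClubVertex N m q) :=
  (List.finRange N).reverse.flatMap (fun i => [lit i true, lit i false]) ++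
    (List.finRange m).flatMap (fun j => [cl j true, cl j false]) ++
    ([hub true true, hub true false, hub false true, hub false false] ++
      (List.finRange q).map apex)

theorem mem_all {N m q : ℕ} (v : ClubVertex N m q) : v ∈ all N m q := by
  cases v with
  | lit i b => cases b <;> simp [all]
  | cl i b => cases b <;> simp [all]
  | hub x y => cases x <;> cases y <;> simp [all]
  | apex i => simp [all]

theorem nodup_all (N m q : ℕ) : (all N m q).Nodup := by
  have h₁ : (List.finRange N).reverse.Nodup := List.nodup_reverse.2 (List.nodup_finRange N)
  have h₂ := List.nodup_finRange m
  have h₃ := List.nodup_finRange q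
  refine List.Nodup.append (List.Nodup.append ?_ ?_ ?_) (List.Nodup.append ?_ ?_ ?_) ?_
  · refine List.nodup_flatMap.2 ⟨by simp, h₁.imp ?_⟩
    intro i j hij
    simp [Function.onFun, hij.symm]
  · refine List.nodup_flatMap.2 ⟨by simp, h₂.imp ?_⟩
    intro i j hij
    simp [Function.onFun, hij.symm]
  · simp [List.Disjoint]
    grind
  · simp
  · exact h₃.map fun i j h => by injection h
  · simp [List.Disjoint]
  · simp [List.Disjoint]
    grind

variable (F : CNFFormula) (q : ℕ)

/-- The vertices of the graph of a formula. -/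
abbrev Of : Type := ClubVertex F.numVars F.clauses.length q

variable {F q}

/-- Adjacency in the graph of a formula. -/
def Adj : Of F q → Of F q → Prop
  | lit i b, lit i' b' => b ≠ b' ∧ i ≠ i'
  | lit i b, cl j _ | cl j _, lit i b => (i, b) ∈ F.clauses.get j ∧ (i, !b) ∉ F.clauses.get j
  -- Clauses are compared as sets of literals, because descriptors carry no clause index. Copies of
  -- a tautological clause are made adjacent, since such a clause imposes no condition.
  | cl j s, cl j' s' => s ≠ s' ∧
      ((∃ l, ¬ (l ∈ F.clauses.get j ↔ l ∈ F.clauses.get j')) ∨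
        ∃ i, (i, true) ∈ F.clauses.get j ∧ (i, false) ∈ F.clauses.get j)
  | lit _ b, hub x _ | hub x _, lit _ b => x = b
  | cl _ s, hub _ y | hub _ y, cl _ s => y = s
  | hub x y, hub x' y' => (x, y) ≠ (x', y')
  | apex i, apex j => i ≠ j
  | apex _, _ | _, apex _ => True

/-- Only the case of two clauses needs an argument: the tautology condition mentions just the first
one, but it matters only if both have the same literals. -/
theorem adj_symm (u v : Of F q) (h : Adj u v) : Adj v u := by
  cases u <;> cases v <;> first | exact h | exact ⟨h.1.symm, h.2.symm⟩ | exact Ne.symm h | skip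
  rename_i j s j' s'
  obtain ⟨hs, h⟩ := h
  refine ⟨hs.symm, ?_⟩
  by_cases hl : ∃ l, ¬ (l ∈ F.clauses.get j' ↔ l ∈ F.clauses.get j)
  · exact Or.inl hl
  · push Not at hl
    rcases h with ⟨l, h⟩ | ⟨i, h₁, h₂⟩
    · exact absurd (hl l).symm h
    · exact Or.inr ⟨i, (hl _).2 h₁, (hl _).2 h₂⟩

variable (F q)

/-- The graph of a formula. -/
def graph : SimpleGraph (Of F q) where
  Adj := Adj
  symm := ⟨adj_symm⟩
  loopless := ⟨fun u h => by cases u <;> simp [Adj] at h⟩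

end ClubVertex

namespace ClubVertex

variable {F : CNFFormula} {q : ℕ}

theorem adj_apex (i : Fin q) (v : Of F q) (hv : v ≠ apex i) : (graph F q).Adj (apex i) v := by
  cases v with
  | apex j => exact fun h => hv (by rw [h])
  | _ => trivial

/-- Any vertex but the apexes is adjacent to a hub. -/
theorem exists_adj_hub (v : Of F q) (hv : ∀ i, v ≠ apex i) :
    ∃ x y, (graph F q).Adj v (hub x y) := by
  cases v with
  | lit i b => exact ⟨b, b, rfl⟩
  | cl j s => exact ⟨s, s, rfl⟩
  | hub x y => exact ⟨!x, y, by simp [graph, Adj]⟩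
  | apex i => exact absurd rfl (hv i)

theorem graph_connected (F : CNFFormula) (q : ℕ) : (graph F q).Connected := by
  have hub_reach : ∀ x y, (graph F q).Reachable (hub x y) (hub true true) := by
    intro x y
    by_cases h : (x, y) = (true, true)
    · obtain ⟨rfl, rfl⟩ := Prod.mk.inj h
      rfl
    · exact SimpleGraph.Adj.reachable (G := graph F q) h
  have reach : ∀ v, (graph F q).Reachable v (hub true true) := by
    intro v
    by_cases hv : ∀ i, v ≠ apex i
    · obtain ⟨x, y, h⟩ := exists_adj_hub v hv
      exact h.reachable.trans (hub_reach x y)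
    · push Not at hv
      obtain ⟨i, rfl⟩ := hv
      exact (adj_apex i (hub true true) (by simp)).reachable
  have : Nonempty (Of F q) := ⟨hub true true⟩
  exact ⟨fun u v => (reach u).trans (reach v).symm⟩

/-- The set of apexes. -/
def apexes (F : CNFFormula) (q : ℕ) : Finset (Of F q) :=
  Finset.univ.map ⟨apex, fun i j h => by injection h⟩

theorem mem_apexes (v : Of F q) : v ∈ apexes F q ↔ ∃ i, v = apex i := by
  simp only [apexes, Finset.mem_map, Finset.mem_univ, true_and, eq_comm]
  rfl

theorem card_apexes : (apexes F q).card = q := by simp [apexes]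

/-- The vertices that are compatible with an assignment. -/
def kept (a : Fin F.numVars → Bool) : Set (Of F q) :=
  {v | ∀ i b, v = lit i b → a i = b}

theorem lit_mem_kept {a : Fin F.numVars → Bool} {i : Fin F.numVars} {b : Bool} :
    (lit i b : Of F q) ∈ kept a ↔ a i = b := by
  constructor
  · exact fun h => h i b rfl
  · rintro h _ _ ⟨⟩
    exact h

theorem mem_kept_of_ne {a : Fin F.numVars → Bool} {v : Of F q} (hv : ∀ i b, v ≠ lit i b) :
    v ∈ kept a := fun i b h => absurd h (hv i b)

theorem hasCommonNeighbors_symm {V : Type} {G : SimpleGraph V} {S : Set V} {q : ℕ} {u v : V}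
    (h : HasCommonNeighbors G S q u v) : HasCommonNeighbors G S q v u := by
  obtain ⟨C, hC, hC'⟩ := h
  exact ⟨C, hC, fun w hw => ⟨(hC' w hw).1, (hC' w hw).2.2.symm, (hC' w hw).2.1.symm⟩⟩

/-- Two kept vertices that are not apexes are adjacent or have a common neighbour that is not an
apex. -/
theorem adj_or_exists_common {a : Fin F.numVars → Bool}
    (ha : ∀ c ∈ F.clauses, ∃ l ∈ c, a l.1 = l.2) {u v : Of F q} (hu : u ∈ kept a)
    (hv : v ∈ kept a) (huv : u ≠ v) (hu' : ∀ i, u ≠ apex i) (hv' : ∀ i, v ≠ apex i) :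
    (graph F q).Adj u v ∨
      ∃ w ∈ kept a, (∀ i, w ≠ apex i) ∧ (graph F q).Adj u w ∧ (graph F q).Adj w v := by
  have viaHub : ∀ x y, (graph F q).Adj u (hub x y) → (graph F q).Adj (hub x y) v →
      ∃ w ∈ kept a, (∀ i, w ≠ apex i) ∧ (graph F q).Adj u w ∧ (graph F q).Adj w v :=
    fun x y h h' => ⟨hub x y, mem_kept_of_ne (by simp), by simp, h, h'⟩
  cases u with
  | apex i => exact absurd rfl (hu' i)
  | lit i b =>
    cases v with
    | apex i => exact absurd rfl (hv' i)
    | lit i' b' =>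
      by_cases hb : b = b'
      · exact Or.inr (viaHub b b rfl hb)
      · refine Or.inl ⟨hb, ?_⟩
        -- Opposite literals of the same variable are not both kept.
        rintro rfl
        exact hb ((lit_mem_kept.1 hu).symm.trans (lit_mem_kept.1 hv))
    | cl j s => exact Or.inr (viaHub b s rfl rfl)
    | hub x y => exact Or.inr (viaHub b (!y) rfl (by simp [graph, Adj]))
  | cl j s =>
    cases v with
    | apex i => exact absurd rfl (hv' i)
    | lit i b => exact Or.inr (viaHub b s rfl rfl)
    | cl j' s' =>
      by_cases hs : s = s'
      · exact Or.inr (viaHub s s rfl hs)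
      · refine or_iff_not_imp_left.2 fun hadj => ?_
        have hsame : ∀ l, l ∈ F.clauses.get j ↔ l ∈ F.clauses.get j' := by
          intro l
          by_contra hl
          exact hadj ⟨hs, Or.inl ⟨l, hl⟩⟩
        have htaut : ∀ i, ¬ ((i, true) ∈ F.clauses.get j ∧ (i, false) ∈ F.clauses.get j) :=
          fun i hi => hadj ⟨hs, Or.inr ⟨i, hi⟩⟩
        -- The clauses have the same literals and are not tautological, so a literal made true by
        -- `a` is a kept common neighbour.
        obtain ⟨⟨i, b⟩, hl, hal⟩ := ha _ (F.clauses.get_mem j)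
        have hother : (i, !b) ∉ F.clauses.get j := by
          intro h
          cases b
          · exact htaut i ⟨h, hl⟩
          · exact htaut i ⟨hl, h⟩
        exact ⟨lit i b, lit_mem_kept.2 hal, by simp, ⟨hl, hother⟩,
          ⟨(hsame _).1 hl, fun h => hother ((hsame _).2 h)⟩⟩
    | hub x y => exact Or.inr (viaHub (!x) s rfl (by simp [graph, Adj]))
  | hub x y =>
    cases v with
    | apex i => exact absurd rfl (hv' i)
    | lit i b => exact Or.inr (viaHub b (!y) (by simp [graph, Adj]) rfl)
    | cl j s => exact Or.inr (viaHub (!x) s (by simp [graph, Adj]) rfl)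
    | hub x' y' => exact Or.inl fun h => huv (by obtain ⟨rfl, rfl⟩ := Prod.mk.inj h; rfl)

/-- The remaining apexes fall short of q by one, or by two if `v` is an apex as well; hubs make up
the difference. -/
theorem hasCommonNeighbors_apex (a : Fin F.numVars → Bool) (i : Fin q) {v : Of F q}
    (hv : v ≠ apex i) : HasCommonNeighbors (graph F q) (kept a) q (apex i) v := by
  have hi : apex i ∈ apexes F q := (mem_apexes _).2 ⟨i, rfl⟩
  have happ : ∀ w ∈ apexes F q, w ∈ kept a := by
    intro w hw
    obtain ⟨k, rfl⟩ := (mem_apexes _).1 hw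
    exact mem_kept_of_ne (by simp)
  by_cases hv' : ∃ j, v = apex j
  · obtain ⟨j, rfl⟩ := hv'
    refine ⟨insert (hub true true) (insert (hub false false)
      (((apexes F q).erase (apex i)).erase (apex j))), ?_, ?_⟩
    · rw [Finset.card_insert_of_notMem (by simp [mem_apexes]),
        Finset.card_insert_of_notMem (by simp [mem_apexes]),
        Finset.card_erase_of_mem (Finset.mem_erase.2 ⟨hv, (mem_apexes _).2 ⟨j, rfl⟩⟩),
        Finset.card_erase_of_mem hi, card_apexes]
      omega
    · intro w hw
      simp only [Finset.mem_insert, Finset.mem_erase] at hw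
      rcases hw with rfl | rfl | ⟨hj, hi', hw⟩
      · exact ⟨mem_kept_of_ne (by simp), trivial, trivial⟩
      · exact ⟨mem_kept_of_ne (by simp), trivial, trivial⟩
      · exact ⟨happ w hw, adj_apex i w hi', (adj_apex j w hj).symm⟩
  · push Not at hv'
    obtain ⟨x, y, hxy⟩ := exists_adj_hub v hv'
    refine ⟨insert (hub x y) ((apexes F q).erase (apex i)), ?_, ?_⟩
    · rw [Finset.card_insert_of_notMem (by simp [mem_apexes]), Finset.card_erase_of_mem hi,
        card_apexes]
      omega
    · intro w hw
      simp only [Finset.mem_insert, Finset.mem_erase] at hw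
      rcases hw with rfl | ⟨hi', hw⟩
      · exact ⟨mem_kept_of_ne (by simp), trivial, hxy.symm⟩
      · obtain ⟨k, rfl⟩ := (mem_apexes _).1 hw
        exact ⟨happ _ hw, adj_apex i _ hi', adj_apex k v (hv' k)⟩

/-- A satisfying assignment yields a robust and hereditary 2-club. -/
theorem isTightlyLinked_kept {a : Fin F.numVars → Bool}
    (ha : ∀ c ∈ F.clauses, ∃ l ∈ c, a l.1 = l.2) :
    IsTightlyLinked (graph F q) (kept a) q := by
  intro u hu v hv huv
  by_cases hu' : ∃ i, u = apex i
  · obtain ⟨i, rfl⟩ := hu'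
    exact Or.inl ⟨adj_apex i v huv.symm, hasCommonNeighbors_apex a i huv.symm⟩
  by_cases hv' : ∃ i, v = apex i
  · obtain ⟨i, rfl⟩ := hv'
    exact Or.inl ⟨(adj_apex i u huv).symm,
      hasCommonNeighbors_symm (hasCommonNeighbors_apex a i huv)⟩
  push Not at hu' hv'
  have happ : ∀ w ∈ apexes F q, w ∈ kept a ∧ (graph F q).Adj u w ∧ (graph F q).Adj w v := by
    intro w hw
    obtain ⟨k, rfl⟩ := (mem_apexes _).1 hw
    exact ⟨mem_kept_of_ne (by simp), (adj_apex k u (hu' k)).symm, adj_apex k v (hv' k)⟩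
  rcases adj_or_exists_common ha hu hv huv hu' hv' with h | ⟨w, hw, hw', h⟩
  · exact Or.inl ⟨h, apexes F q, card_apexes.ge, happ⟩
  · refine Or.inr ⟨insert w (apexes F q), ?_, ?_⟩
    · rw [Finset.card_insert_of_notMem, card_apexes]
      rw [mem_apexes]
      push Not
      exact hw'
    · intro x hx
      rcases Finset.mem_insert.1 hx with rfl | hx
      · exact ⟨hw, h⟩
      · exact happ x hx

/-- There are only q apexes. -/
theorem HasCommonNeighbors.exists_ne_apex {S : Set (Of F q)} {u v : Of F q}
    (h : HasCommonNeighbors (graph F q) S (q + 1) u v) :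
    ∃ w ∈ S, (∀ i, w ≠ apex i) ∧ (graph F q).Adj u w ∧ (graph F q).Adj w v := by
  obtain ⟨C, hC, hC'⟩ := h
  obtain ⟨w, hw, hw'⟩ := Finset.exists_mem_notMem_of_card_lt_card (s := apexes F q) (t := C)
    (by rw [card_apexes]; omega)
  refine ⟨w, (hC' w hw).1, ?_, (hC' w hw).2⟩
  rw [mem_apexes] at hw'
  push Not at hw'
  exact hw'

/-- Opposite literals do not both belong to a 2-club. -/
theorem exists_lit_notMem {S : Set (Of F q)} (hS : IsLooselyLinked (graph F q) S q)
    (i : Fin F.numVars) : ∃ b, lit i b ∉ S := by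
  by_contra hcon
  push Not at hcon
  obtain ⟨w, -, hw, h₁, h₂⟩ := HasCommonNeighbors.exists_ne_apex
    (hS _ (hcon true) _ (hcon false) (by simp) (by simp [graph, Adj]))
  cases w with
  | lit i' b => cases b <;> simp [graph, Adj] at h₁ h₂
  | cl j s => exact h₁.2 h₂.1
  | hub x y =>
    have h₃ : x = true := h₁
    exact Bool.noConfusion (h₃.symm.trans h₂)
  | apex k => exact hw k rfl

/-- A large 2-club yields a satisfying assignment. -/
theorem satisfiable_of_isLooselyLinked {S : Finset (Of F q)}
    (hS : IsLooselyLinked (graph F q) (S : Set (Of F q)) q)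
    (hcard : ∀ D : Finset (Of F q), (∀ v ∈ D, v ∉ S) → D.card ≤ F.numVars) : F.Satisfiable := by
  choose f hf using exists_lit_notMem hS
  -- The missing literals `lit i (f i)`, one for each variable, already exhaust the N vertices that
  -- may be absent.
  have hmem : ∀ v : Of F q, (∀ i, v ≠ lit i (f i)) → v ∈ S := by
    intro v hv
    by_contra hvS
    have h := hcard (insert v (Finset.univ.map
      ⟨fun i => lit i (f i), fun i j h => by injection h⟩)) (by
        intro w hw
        rcases Finset.mem_insert.1 hw with rfl | hw
        · exact hvS
        · obtain ⟨i, -, rfl⟩ := Finset.mem_map.1 hw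
          exact fun h => hf i (Finset.mem_coe.2 h))
    rw [Finset.card_insert_of_notMem] at h
    · simp at h
    · simpa using fun i h => hv i h.symm
  refine ⟨fun i => !f i, fun c hc => ?_⟩
  obtain ⟨j, rfl⟩ := List.get_of_mem hc
  by_cases htaut : ∃ i, (i, true) ∈ F.clauses.get j ∧ (i, false) ∈ F.clauses.get j
  · obtain ⟨i, h₁, h₂⟩ := htaut
    cases h : f i
    · exact ⟨_, h₁, by simp [h]⟩
    · exact ⟨_, h₂, by simp [h]⟩
  · obtain ⟨w, hwS, hw, h₁, h₂⟩ := HasCommonNeighbors.exists_ne_apex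
      (hS (cl j true) (hmem _ (by simp)) (cl j false) (hmem _ (by simp)) (by simp) (by
        rintro ⟨-, ⟨l, hl⟩ | h⟩
        · exact hl Iff.rfl
        · exact htaut h))
    -- Another clause copy or a hub would need a sign agreeing, or disagreeing, with both `true` and
    -- `false`; only a literal of the clause remains.
    cases w with
    | lit i b =>
      refine ⟨(i, b), h₁.1, ?_⟩
      by_contra hb
      refine hf i ?_
      have : f i = b := by
        cases hfi : f i <;> cases b <;> simp_all
      rw [this]
      exact hwS
    | cl j' s => cases s <;> simp [graph, Adj] at h₁ h₂
    | hub x y =>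
      have h₃ : y = true := h₁
      exact Bool.noConfusion (h₃.symm.trans h₂)
    | apex k => exact absurd rfl (hw k)

end ClubVertex

/-! ### The machines compute the encoding of the graph -/

namespace ClubVertex

open VectorMachine

section Vectors

theorem getElem_foldl_modify {N : ℕ} (c : List (Fin N × Bool)) (v : List (Bool × Bool))
    (p : Fin N) (hp : (p : ℕ) < v.length)
    (hp' : (p : ℕ) < (c.foldl (fun v l => v.modify l.1 (mark l.2)) v).length) :
    (c.foldl (fun v l => v.modify l.1 (mark l.2)) v)[(p : ℕ)] =
      (v[(p : ℕ)].1 || decide ((p, true) ∈ c), v[(p : ℕ)].2 || decide ((p, false) ∈ c)) := by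
  induction c generalizing v with
  | nil => simp
  | cons l c ih =>
    obtain ⟨k, b⟩ := l
    simp only [List.foldl_cons]
    rw [ih _ (by simpa using hp)]
    rw [List.getElem_modify]
    by_cases hk : k = p
    · subst hk
      cases b <;> simp [mark]
    · have : (k : ℕ) ≠ p := fun h => hk (Fin.ext h)
      have hk' : p ≠ k := Ne.symm hk
      simp [this, hk']

theorem clauseVec_eq {N : ℕ} (c : List (Fin N × Bool)) :
    clauseVec c = List.ofFn fun p : Fin N => (decide ((p, true) ∈ c), decide ((p, false) ∈ c)) := by
  refine List.ext_getElem (by simp) fun p h₁ h₂ => ?_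
  have hp : p < N := by simpa using h₁
  have := getElem_foldl_modify c (List.replicate N (false, false)) ⟨p, hp⟩ (by simpa using hp) h₁
  rw [List.getElem_ofFn]
  exact this.trans (by simp)

/-- The vector is kept on a stack and written from its bottom, whence the reversed order of the
variables. -/
theorem unitVec_eq {N : ℕ} (i : Fin N) :
    unitVec (N - 1 - i) i = (List.ofFn fun p : Fin N => (decide (p = i), decide (p = i))).reverse := by
  have h : unitVec (N - 1 - i) i = (unitVec i (N - 1 - i)).reverse := by
    simp [unitVec]
  rw [h]
  congr 1
  have hi := i.2
  refine List.ext_getElem (by simp; omega) fun p h₁ h₂ => ?_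
  have hp : p < N := by simpa using h₂
  simp only [unitVec, List.getElem_append, List.length_replicate, List.getElem_replicate,
    List.getElem_cons, List.getElem_ofFn, Fin.ext_iff]
  split_ifs with h₃ h₄
  · simp; omega
  · simp; omega
  · simp; omega

/-- Both vectors are reversed and have the same length, so equal positions still belong to the same
variable. -/
theorem any_zip_reverse_ofFn {α : Type} {N : ℕ} (f g : Fin N → α) (h : α → α → Bool) :
    (((List.ofFn f).reverse.zip (List.ofFn g).reverse).any fun x => h x.1 x.2) =
      decide (∃ p, h (f p) (g p) = true) := by
  have e : (List.ofFn f).reverse.zip (List.ofFn g).reverse =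
      (List.ofFn fun p => (f p, g p)).reverse := by
    rw [List.zip_eq_zipWith, ← List.reverse_zipWith (by simp), ← List.zip_eq_zipWith]
    congr 1
    exact List.ext_getElem (by simp) fun p h₁ h₂ => by simp
  rw [e, List.any_reverse, Bool.eq_iff_iff]
  simp [List.any_eq_true, List.mem_ofFn]

end Vectors

variable {F : CNFFormula} {q : ℕ}

/-- The descriptor of a vertex. -/
def desc : Of F q → ClubTag q × List (Bool × Bool)
  | lit i b => (.lit b, (List.ofFn fun p => (decide (p = i), decide (p = i))).reverse)
  | cl j s => (.cl s, (List.ofFn fun p => (decide ((p, true) ∈ F.clauses.get j),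
      decide ((p, false) ∈ F.clauses.get j))).reverse)
  | hub x y => (.hub x y, [])
  | apex i => (.apex i, [])

theorem length_desc_le (v : Of F q) : (desc v).2.length ≤ F.numVars := by
  cases v <;> simp [desc]

theorem litDescs_eq {τ : Type} (g : Tags τ) (a b : ℕ) :
    litDescs g a b = (List.range (b + 1)).reverse.flatMap fun i =>
      [(g.lit true, unitVec (a + b - i) i), (g.lit false, unitVec (a + b - i) i)] := by
  induction b generalizing a with
  | zero => simp [litDescs]
  | succ b ih =>
    rw [List.range_succ, List.reverse_append, List.flatMap_append, litDescs, ih]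
    simp [show a + 1 + b = a + (b + 1) by omega]

theorem allLitDescs_eq {τ : Type} (g : Tags τ) (N : ℕ) :
    allLitDescs g N = (List.finRange N).reverse.flatMap fun i : Fin N =>
      [(g.lit true, unitVec (N - 1 - i) i), (g.lit false, unitVec (N - 1 - i) i)] := by
  cases N with
  | zero => rfl
  | succ N =>
    rw [allLitDescs, litDescs_eq, ← List.map_coe_finRange_eq_range, ← List.map_reverse, List.flatMap_map]
    simp

/-- The machine writes the descriptors of all vertices. -/
theorem descs_eq (F : CNFFormula) (q : ℕ) :
    descs (ClubTag.tags q) F = (all F.numVars F.clauses.length q).map (desc (F := F)) := by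
  have hc : F.clauses.flatMap (clauseDescs (ClubTag.tags q)) =
      (List.finRange F.clauses.length).flatMap fun j =>
        clauseDescs (ClubTag.tags q) (F.clauses.get j) := by
    conv_lhs => rw [← List.map_get_finRange F.clauses, List.flatMap_map]
  rw [descs, allLitDescs_eq, hc, all]
  simp only [List.map_append, List.map_flatMap, List.map_cons, List.map_nil, List.map_map]
  congr 1
  · congr 1
    · simp [desc, unitVec_eq, ClubTag.tags]
    · simp [desc, clauseDescs, clauseVec_eq, ClubTag.tags]
  · simp [ClubTag.tags, ClubTag.tail, desc, Function.comp_def]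

theorem bit_ofFn {τ : Type} (p : PairTest τ (Bool × Bool)) (x y : τ) {N : ℕ}
    (f g : Fin N → Bool × Bool) :
    p.bit (x, (List.ofFn f).reverse) (y, (List.ofFn g).reverse) = true ↔
      p.base x y = true ∨ ∃ i, p.sym x y (f i) (g i) = true := by
  rw [PairTest.bit, any_zip_reverse_ofFn, Bool.or_eq_true, decide_eq_true_iff]

/-- The adjacency test computes adjacency. -/
theorem bit_desc (u v : Of F q) :
    (ClubTag.test q).bit (desc u) (desc v) = true ↔ (graph F q).Adj u v := by
  cases u with
  | lit i b =>
    cases v with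
    | lit i' b' =>
      simp only [desc, bit_ofFn, ClubTag.test, ClubTag.base, ClubTag.sym, graph, Adj]
      simp
      intro _
      constructor
      · rintro ⟨x, hx⟩ rfl
        exact hx Iff.rfl
      -- The unit vectors of two different variables differ at position `i`.
      · exact fun h => ⟨i, fun h' => h (h'.1 rfl)⟩
    | cl j s =>
      simp only [desc, bit_ofFn, ClubTag.test, ClubTag.base, ClubTag.sym, graph, Adj]
      cases b <;> simp
      exact and_comm
    | _ => simp [PairTest.bit, desc, ClubTag.test, ClubTag.base, graph, Adj]
  | cl j s =>
    cases v with
    | lit i b =>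
      simp only [desc, bit_ofFn, ClubTag.test, ClubTag.base, ClubTag.sym, graph, Adj]
      cases b <;> simp
      exact and_comm
    | cl j' s' =>
      simp only [desc, bit_ofFn, ClubTag.test, ClubTag.base, ClubTag.sym, graph, Adj]
      simp
      intro _
      rw [← exists_or]
      refine exists_congr fun x => ?_
      tauto
    | _ => simp [PairTest.bit, desc, ClubTag.test, ClubTag.base, graph, Adj]
  | hub x y => cases v <;> simp [PairTest.bit, desc, ClubTag.test, ClubTag.base, graph, Adj]
  | apex i => cases v <;> simp [PairTest.bit, desc, ClubTag.test, ClubTag.base, graph, Adj]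

/-- The numbering of the vertices. -/
def numbering (F : CNFFormula) (q : ℕ) : Fin (all F.numVars F.clauses.length q).length ≃ Of F q :=
  (nodup_all _ _ _).getEquivOfForallMemList _ mem_all

theorem length_all (N m q : ℕ) : (all N m q).length = 2 * N + 2 * m + 4 + q := by
  simp [all]
  omega

/-- The instance of the 2-club problem for a formula. -/
def instanceOf (F : CNFFormula) (q t : ℕ) : ClubInstance where
  n := (all F.numVars F.clauses.length q).length
  graph := (graph F q).comap (numbering F q)
  t := t
  k := (all F.numVars F.clauses.length q).length - F.numVars

/-- This is how the machine obtains k without subtracting: it counts all vertices except the N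
positive literals. -/
theorem countP_all (F : CNFFormula) (q : ℕ) :
    (all F.numVars F.clauses.length q).countP
      (fun v : Of F q => (ClubTag.test q).counted (desc v).1) =
      (all F.numVars F.clauses.length q).length - F.numVars := by
  rw [length_all]
  have h : ∀ i : Fin q, (ClubTag.apex i != ClubTag.lit true) = true := fun i => by
    rw [bne_iff_ne]
    exact nofun
  simp [all, List.countP_flatMap, ClubTag.test, desc, Function.comp_def, h]
  omega

/-- The machine writes the encoding of the instance. -/
theorem output_descs (F : CNFFormula) (q t : ℕ) :
    (ClubTag.test q).output t (descs (ClubTag.tags q) F) = (instanceOf F q t).encode := by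
  classical
  have hall : all F.numVars F.clauses.length q =
      (List.finRange (all F.numVars F.clauses.length q).length).map (numbering F q) :=
    (List.map_get_finRange _).symm
  rw [descs_eq, PairTest.output, List.countP_map, List.length_map, ClubInstance.encode]
  congr 1
  · congr 2
    exact congrArg encodeUnary (countP_all F q)
  · conv_lhs => rw [hall]
    simp only [List.map_map, List.flatMap_map]
    refine List.flatMap_congr fun i _ => List.map_congr_left fun j _ => ?_
    refine congrArg some ?_
    rw [Bool.eq_iff_iff, decide_eq_true_iff]
    exact bit_desc _ _

theorem instanceOf_connected (F : CNFFormula) (q t : ℕ) : (instanceOf F q t).graph.Connected :=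
  (SimpleGraph.Iso.connected_iff (SimpleGraph.Iso.comap (numbering F q) (graph F q))).2
    (graph_connected F q)

theorem instanceOf_sub (F : CNFFormula) (q t : ℕ) :
    (instanceOf F q t).n - (instanceOf F q t).k = F.numVars := by
  have := length_all F.numVars F.clauses.length q
  simp only [instanceOf]
  omega

/-! ### Correctness of the reduction for the numbered graph -/

theorem hasCommonNeighbors_comap {V W : Type} (e : V ≃ W) (G : SimpleGraph W) (S : Set W) (r : ℕ)
    (u v : V) :
    HasCommonNeighbors (G.comap e) (e ⁻¹' S) r u v ↔ HasCommonNeighbors G S r (e u) (e v) := by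
  constructor
  · rintro ⟨C, hC, hC'⟩
    refine ⟨C.map e.toEmbedding, by simpa using hC, fun w hw => ?_⟩
    obtain ⟨x, hx, rfl⟩ := Finset.mem_map.1 hw
    exact hC' x hx
  · rintro ⟨C, hC, hC'⟩
    refine ⟨C.map e.symm.toEmbedding, by simpa using hC, fun w hw => ?_⟩
    obtain ⟨x, hx, rfl⟩ := Finset.mem_map.1 hw
    simpa using hC' x hx

/-- A satisfiable formula yields a large 2-club. -/
theorem exists_isTightlyLinked (F : CNFFormula) (q t : ℕ) (h : F.Satisfiable) :
    ∃ S : Finset (Fin (instanceOf F q t).n), (instanceOf F q t).k ≤ S.card ∧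
      IsTightlyLinked (instanceOf F q t).graph (S : Set (Fin (instanceOf F q t).n)) q := by
  classical
  obtain ⟨a, ha⟩ := h
  let e : Fin (instanceOf F q t).n ≃ Of F q := numbering F q
  -- The deleted vertices are the false literals, one for each variable.
  let R : Finset (Fin (instanceOf F q t).n) := Finset.univ.image fun i => e.symm (lit i (!a i))
  have hR : ∀ v, v ∉ R ↔ e v ∈ kept a := by
    intro v
    simp only [R, Finset.mem_image, Finset.mem_univ, true_and, not_exists]
    constructor
    · intro h i b hv
      by_contra hab
      refine h i ?_
      rw [Equiv.symm_apply_eq, hv]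
      congr 1
      cases hai : a i <;> cases b <;> simp_all
    · intro h i hi
      rw [Equiv.symm_apply_eq] at hi
      have := h i _ hi.symm
      revert this
      cases a i <;> decide
  refine ⟨Rᶜ, ?_, ?_⟩
  · have h₁ : R.card ≤ F.numVars := Finset.card_image_le.trans (by simp)
    have h₂ := Finset.card_compl R
    rw [Fintype.card_fin] at h₂
    have h₃ : (instanceOf F q t).k = (instanceOf F q t).n - F.numVars := rfl
    omega
  · have hS : ((Rᶜ : Finset _) : Set (Fin (instanceOf F q t).n)) = e ⁻¹' kept a := by
      ext v
      simpa using hR v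
    rw [hS]
    intro u hu v hv huv
    have := isTightlyLinked_kept (q := q) ha (e u) hu (e v) hv (fun h => huv (e.injective h))
    rw [← hasCommonNeighbors_comap, ← hasCommonNeighbors_comap] at this
    exact this

/-- A large 2-club yields a satisfying assignment. -/
theorem satisfiable_of_large (F : CNFFormula) (q t : ℕ)
    (S : Finset (Fin (instanceOf F q t).n)) (hk : (instanceOf F q t).k ≤ S.card)
    (hS : IsLooselyLinked (instanceOf F q t).graph (S : Set (Fin (instanceOf F q t).n)) q) :
    F.Satisfiable := by
  classical
  let e : Fin (instanceOf F q t).n ≃ Of F q := numbering F q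
  have hpre : (S : Set (Fin (instanceOf F q t).n)) =
      e ⁻¹' ((S.map e.toEmbedding : Finset (Of F q)) : Set (Of F q)) := by
    ext v
    simp
  refine satisfiable_of_isLooselyLinked (q := q) (S := S.map e.toEmbedding) ?_ ?_
  · intro u hu v hv huv hadj
    rw [hpre] at hS
    have := hS (e.symm u) (by simpa using hu) (e.symm v) (by simpa using hv)
      (fun h => huv (e.symm.injective h))
      (by
        change ¬ (graph F q).Adj (e (e.symm u)) (e (e.symm v))
        simpa using hadj)
    have h := (hasCommonNeighbors_comap e (graph F q) _ _ _ _).1 this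
    simpa using h
  · intro D hD
    -- Disjointness from `S` gives |D| + |S| ≤ n, while |S| ≥ k and n - k = N.
    have h₁ : Disjoint (D.map e.symm.toEmbedding) S := by
      rw [Finset.disjoint_left]
      intro x hx hxS
      obtain ⟨v, hv, rfl⟩ := Finset.mem_map.1 hx
      exact hD v hv (Finset.mem_map.2 ⟨_, hxS, by simp⟩)
    have h₂ := Finset.card_union_of_disjoint h₁
    have h₃ := Finset.card_le_univ (D.map e.symm.toEmbedding ∪ S)
    rw [Fintype.card_fin] at h₃
    rw [Finset.card_map] at h₂
    have h₄ := instanceOf_sub F q t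
    omega

theorem hasRobustTwoClub_iff (F : CNFFormula) (q : ℕ) :
    (instanceOf F q (q + 1)).HasRobustTwoClub ↔ F.Satisfiable := by
  constructor
  · rintro ⟨S, hk, hS⟩
    exact satisfiable_of_large F q (q + 1) S hk hS.isLooselyLinked
  · intro h
    obtain ⟨S, hk, hS⟩ := exists_isTightlyLinked F q (q + 1) h
    exact ⟨S, hk, hS.isRobustTwoClub⟩

theorem hasHereditaryTwoClub_iff (F : CNFFormula) (q : ℕ) :
    (instanceOf F q q).HasHereditaryTwoClub ↔ F.Satisfiable := by
  constructor
  · rintro ⟨S, hk, hS⟩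
    exact satisfiable_of_large F q q S hk hS.isLooselyLinked
  · intro h
    obtain ⟨S, hk, hS⟩ := exists_isTightlyLinked F q q h
    exact ⟨S, hk, hS.isHereditaryTwoClub⟩

end ClubVertex

/-! ### Running times -/

namespace ClubVertex

open VectorMachine PairTest Turing

/-- Each variable costs a unary digit and each clause a separator; the separator after the digits
makes the inequality strict. -/
theorem length_clauses_add_numVars_lt (F : CNFFormula) :
    F.clauses.length + F.numVars < F.encode.length := by
  have h : ∀ cs : List (List (Fin F.numVars × Bool)),
      cs.length ≤ (cs.flatMap fun c => litString c ++ [none]).length := by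
    intro cs
    induction cs with
    | nil => simp
    | cons c cs ih =>
      rw [List.flatMap_cons, List.length_append, List.length_append, List.length_cons,
        List.length_singleton]
      omega
  have e : F.encode = encodeUnary F.numVars ++
    F.clauses.flatMap fun c => litString c ++ [none] := rfl
  rw [e, List.length_append]
  have := h F.clauses
  simp only [encodeUnary, List.length_append, List.length_replicate, List.length_singleton]
  omega

theorem length_words_le {τ α : Type} (D : List (τ × List α)) (B : ℕ)
    (hB : ∀ d ∈ D, d.2.length ≤ B) : (words D).length ≤ D.length * (B + 1) := by
  induction D with
  | nil => simp
  | cons d D ih =>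
    have h₁ := ih fun d hd => hB d (List.mem_cons_of_mem _ hd)
    have h₂ := hB d List.mem_cons_self
    have h₃ := Nat.add_one_mul D.length (B + 1)
    simp only [words_cons, List.length_cons, List.length_append, List.length_map]
    omega

theorem length_encode (x : ClubInstance) :
    x.encode.length = x.t + x.k + x.n + 3 + x.n * x.n := by
  simp [ClubInstance.encode, encodeUnary]
  omega

/-- The machine that decides satisfiability by means of a machine for a 2-club problem. -/
noncomputable def decider (q t : ℕ) (M : TM2ComputableAux (Option Bool) Bool) :
    TM2ComputableAux (Option Bool) Bool where
  tm := FinTM2.comp (VectorMachine.machine (ClubTag.tags q))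
    (FinTM2.comp ((ClubTag.test q).machine t (Sum.inl (.lit true)) (false, false)) M.tm
      M.inputAlphabet.symm (M.inputAlphabet.symm none)) id (Sum.inl (.lit true))
  inputAlphabet := Equiv.refl (Option Bool)
  outputAlphabet := M.outputAlphabet

theorem decider_yields (q t : ℕ) (M : TM2ComputableAux (Option Bool) Bool) (F : CNFFormula)
    (T : ℕ) (s : List (M.tm.Γ M.tm.k₁))
    (h : M.tm.Yields T ((instanceOf F q t).encode.map M.inputAlphabet.symm) s) :
    (decider q t M).tm.Yields (100 * ((4 + q + t) * F.encode.length) ^ 3 + T) F.encode s := by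
  have hB : ∀ d ∈ descs (ClubTag.tags q) F, d.2.length ≤ F.numVars := by
    intro d hd
    rw [descs_eq] at hd
    obtain ⟨v, -, rfl⟩ := List.mem_map.1 hd
    exact length_desc_le v
  have h₁ := yields_words (ClubTag.tags q) F
  have h₂ := (ClubTag.test q).yields_output t (Sum.inl (.lit true)) (false, false)
    (descs (ClubTag.tags q) F) F.numVars hB
  rw [output_descs] at h₂
  have h₃ := FinTM2.Yields.comp (M := M.tm) M.inputAlphabet.symm (M.inputAlphabet.symm none)
    h₂ rfl h
  have h₄ := FinTM2.Yields.comp id (Sum.inl (ClubTag.lit true)) h₁ (List.map_id _) h₃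
  refine ReachesWithin.mono h₄ ?_
  change 3 * F.numVars * F.numVars + 5 * F.numVars + 2 * F.encode.length +
    F.clauses.length * (3 * F.numVars + 4) + 3 +
    ((words (descs (ClubTag.tags q) F)).length + 1) +
    ((descs (ClubTag.tags q) F).length *
      (3 * F.numVars + 2 * (words (descs (ClubTag.tags q) F)).length +
        (descs (ClubTag.tags q) F).length * (F.numVars + 2) + 6) +
      3 * (words (descs (ClubTag.tags q) F)).length + 5 +
      ((instanceOf F q t).encode.length + 1) + T) ≤
    100 * ((4 + q + t) * F.encode.length) ^ 3 + T
  have hw := length_words_le _ _ hB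
  have hD : (descs (ClubTag.tags q) F).length = (instanceOf F q t).n := by
    rw [descs_eq, List.length_map]
    rfl
  have hn : (instanceOf F q t).n = 2 * F.numVars + 2 * F.clauses.length + 4 + q := length_all _ _ _
  have hk : (instanceOf F q t).k ≤ (instanceOf F q t).n := Nat.sub_le _ _
  have ht : (instanceOf F q t).t = t := rfl
  have hL := length_clauses_add_numVars_lt F
  rw [length_encode]
  rw [hD] at hw ⊢
  rw [ht]
  clear h h₁ h₂ h₃ h₄ hB
  generalize (instanceOf F q t).n = n at *
  generalize (instanceOf F q t).k = k at *
  generalize (words (descs (ClubTag.tags q) F)).length = W at *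
  generalize F.encode.length = L at *
  generalize F.clauses.length = m at *
  generalize F.numVars = N at *
  -- All quantities except `W` are at most `X`, and `W` is at most its square. The dominant term,
  -- the comparison of all pairs, is cubic; the factor 100 is generous.
  obtain ⟨X, hX⟩ : ∃ X, X = (4 + q + t) * L := ⟨_, rfl⟩
  rw [← hX]
  have hX' : (4 + q + t) * 1 + (4 + q + t) * (L - 1) = X := by
    rw [hX, ← Nat.mul_add, Nat.add_sub_cancel' (by omega)]
  have hX'' : 4 * (L - 1) ≤ (4 + q + t) * (L - 1) := Nat.mul_le_mul_right _ (by omega)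
  have hnX : n ≤ X := by omega
  have hNX : N + 2 ≤ X := by omega
  have hLX : L ≤ X := by omega
  have htX : t ≤ X := by omega
  have hmX : m ≤ X := by omega
  have hWX : W ≤ X * X := hw.trans (Nat.mul_le_mul hnX (by omega))
  have e₁ : 3 * N * N ≤ 3 * (X * X) := by
    rw [Nat.mul_assoc]
    exact Nat.mul_le_mul_left 3 (Nat.mul_le_mul (by omega) (by omega))
  have e₂ : m * (3 * N + 4) ≤ X * (3 * X) := Nat.mul_le_mul hmX (by omega)
  have e₃ : n * (N + 2) ≤ X * X := Nat.mul_le_mul hnX hNX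
  have e₄ : n * (3 * N + 2 * W + n * (N + 2) + 6) ≤ X * (3 * X + 3 * (X * X)) :=
    Nat.mul_le_mul hnX (by omega)
  have e₅ : n * n ≤ X * X := Nat.mul_le_mul hnX hnX
  have e₆ : X * X ≤ X ^ 3 := by
    calc X * X = X * X * 1 := (mul_one _).symm
      _ ≤ X * X * X := Nat.mul_le_mul_left _ (by omega)
      _ = X ^ 3 := by ring
  have e₇ : X ≤ X * X := Nat.le_mul_self X
  have e₈ : X * (3 * X) = 3 * (X * X) := by ring
  have e₉ : X * (3 * X + 3 * (X * X)) = 3 * (X * X) + 3 * X ^ 3 := by ring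
  omega

end ClubVertex

open ClubVertex Turing in
/-- An algorithm for a 2-club problem to which satisfiability reduces refutes the strong exponential
time hypothesis. -/
theorem not_admitsDualParameterAlgorithm (hSETH : StrongExponentialTimeHypothesis)
    (yes : ClubInstance → Prop) (q t : ℕ)
    (hyes : ∀ F, yes (instanceOf F q t) ↔ F.Satisfiable) (ε : ℝ) (hε : 0 < ε) :
    ¬ AdmitsDualParameterAlgorithm yes t ε := by
  classical
  rintro ⟨C, c, M, hM⟩
  rcases le_or_gt 2 ε with hε₂ | hε₂
  -- For ε ≥ 2 the time bound on this one-vertex instance, where n - k = 1, is not positive; but the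
  -- machine cannot have halted after zero steps.
  · have hconn : (⊥ : SimpleGraph (Fin 1)).Connected :=
      ⟨fun u v => by rw [Subsingleton.elim u v]⟩
    obtain ⟨T, hT, hT'⟩ := hM ⟨1, ⊥, t, 0⟩ ⟨rfl, hconn, Nat.zero_le _⟩
    rw [FinTM2.nonempty_outputsInTime_iff] at hT'
    obtain ⟨n, hn, e⟩ := hT'
    have : (T : ℝ) ≤ 0 := by
      refine hT.trans ?_
      have : (C : ℝ) * (2 - ε) ≤ 0 :=
        mul_nonpos_of_nonneg_of_nonpos (Nat.cast_nonneg C) (by linarith)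
      simpa using this
    have hT0 : T = 0 := by exact_mod_cast le_antisymm this (Nat.cast_nonneg T)
    obtain rfl : n = 0 := by omega
    have h := congrArg TM2.Cfg.l (Option.some.inj e)
    cases h
  -- Replacing ε by min ε 1 keeps the base at least 1, so that the factor (2 - min ε 1) ^ N also
  -- absorbs the polynomial cost of the reduction.
  · refine hSETH (min ε 1) (lt_min hε one_pos) ?_
    refine ⟨100 * (4 + q + t) ^ 3 + C * (4 + q + t) ^ c, 3 + c, decider q t M, fun F _ => ?_⟩
    have hsub := instanceOf_sub F q t
    obtain ⟨T, hT, hT'⟩ := hM (instanceOf F q t)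
      ⟨rfl, instanceOf_connected F q t, Nat.sub_le _ _⟩
    rw [FinTM2.nonempty_outputsInTime_iff] at hT'
    have h := decider_yields q t M F T _ hT'
    refine ⟨100 * ((4 + q + t) * F.encode.length) ^ 3 + T, ?_,
      (FinTM2.nonempty_outputsInTime_iff _).2 ?_⟩
    rotate_left
    · have e₁ : F.encode.map (decider q t M).inputAlphabet.symm = F.encode := List.map_id _
      rw [e₁]
      rw [decide_eq_decide.2 (hyes F)] at h
      exact h
    · simp only [hsub] at hT
      have hL := length_clauses_add_numVars_lt F
      have hn : (instanceOf F q t).n = 2 * F.numVars + 2 * F.clauses.length + 4 + q :=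
        length_all _ _ _
      set L := F.encode.length
      have hnL : (instanceOf F q t).n ≤ (4 + q + t) * L := by
        have h₁ : (4 + q + t) * 1 + (4 + q + t) * (L - 1) = (4 + q + t) * L := by
          rw [← Nat.mul_add, Nat.add_sub_cancel' (by omega)]
        have h₂ : 4 * (L - 1) ≤ (4 + q + t) * (L - 1) := Nat.mul_le_mul_right _ (by omega)
        omega
      have hL1 : (1 : ℝ) ≤ L := by
        have : 1 ≤ L := by omega
        exact_mod_cast this
      have hb : 1 ≤ 2 - min ε 1 := by linarith [min_le_right ε 1]
      have hb' : 2 - ε ≤ 2 - min ε 1 := by linarith [min_le_left ε 1]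
      have hp : (1 : ℝ) ≤ (2 - min ε 1) ^ F.numVars := one_le_pow₀ hb
      have h₁ : (T : ℝ) ≤ C * (2 - min ε 1) ^ F.numVars * (((4 + q + t : ℕ) : ℝ) * L) ^ c := by
        refine hT.trans ?_
        have : ((instanceOf F q t).n : ℝ) ≤ ((4 + q + t : ℕ) : ℝ) * L := by exact_mod_cast hnL
        gcongr
      have h₂ : (((4 + q + t : ℕ) : ℝ) * L) ^ c ≤ ((4 + q + t : ℕ) : ℝ) ^ c * (L : ℝ) ^ (3 + c) := by
        rw [mul_pow]
        gcongr
        omega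
      have h₃ : (((4 + q + t : ℕ) : ℝ) * L) ^ 3 ≤
          (2 - min ε 1) ^ F.numVars * (((4 + q + t : ℕ) : ℝ) ^ 3 * (L : ℝ) ^ (3 + c)) := by
        rw [mul_pow]
        refine le_trans ?_ (le_mul_of_one_le_left (by positivity) hp)
        gcongr
        omega
      calc ((100 * ((4 + q + t) * L) ^ 3 + T : ℕ) : ℝ)
          = 100 * (((4 + q + t : ℕ) : ℝ) * L) ^ 3 + T := by push_cast; ring
        _ ≤ 100 * ((2 - min ε 1) ^ F.numVars * (((4 + q + t : ℕ) : ℝ) ^ 3 * (L : ℝ) ^ (3 + c))) +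
            C * (2 - min ε 1) ^ F.numVars * (((4 + q + t : ℕ) : ℝ) ^ c * (L : ℝ) ^ (3 + c)) := by
          refine add_le_add (by linarith) (h₁.trans ?_)
          gcongr
        _ = _ := by push_cast; ring

theorem mainTheorem4 (hSETH : StrongExponentialTimeHypothesis) :
    (∀ t : ℕ, 1 ≤ t → ∀ ε : ℝ, 0 < ε →
      ¬ AdmitsDualParameterAlgorithm ClubInstance.HasRobustTwoClub t ε) ∧
    (∀ t : ℕ, ∀ ε : ℝ, 0 < ε →
      ¬ AdmitsDualParameterAlgorithm ClubInstance.HasHereditaryTwoClub t ε) := by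
  refine ⟨fun t ht ε hε => ?_, fun t ε hε => ?_⟩
  · obtain ⟨q, rfl⟩ := Nat.exists_eq_add_of_le' ht
    exact not_admitsDualParameterAlgorithm hSETH _ q _
      (fun F => ClubVertex.hasRobustTwoClub_iff F q) ε hε
  · exact not_admitsDualParameterAlgorithm hSETH _ t _
      (fun F => ClubVertex.hasHereditaryTwoClub_iff F t) ε hε
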